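/- Conventions. An operator system is a triple $(\mathcal S,\{M_n(\mathcal S)^+\}_{n},e)$, where $\mathcal S$ is a complex $*$-vector space, each $M_n(\mathcal S)^+$ is a proper cone of hermitian matrices in $M_n(\mathcal S)$, $\alpha^* M_n(\mathcal S)^+\alpha\subseteq M_m(\mathcal S)^+$ for every scalar $n\times m$ matrix $\alpha$, and $e^{(n)}=\mathrm{diag}(e,\dots,e)$ is an Archimedean order unit of $M_n(\mathcal S)$ for each $n$; its matrix norms are $\|X\|=\inf\{r\ge 0: \begin{pmatrix} re^{(n)} & X\\ X^* & re^{(n)}\end{pmatrix}\in M_{2n}(\mathcal S)^+\}$, $X\in M_n(\mathcal S)$. Morphisms are the unital completely positive linear maps. A subspace $J\subseteq\mathcal S$ is a kernel if $J=\ker\varphi$ for some unital completely positive map $\varphi$ from $\mathcal S$ into an operator system. Then $\mathcal S/J$, with the involution $(x+J)^*=x^*+J$, the unit $e+J$ and the cones $$\{(x_{ij}+J)\in M_n(\mathcal S/J):\ \forall r>0\ \exists k_{ij}\in J \text{ with } re^{(n)}+(x_{ij}+k_{ij})\in M_n(\mathcal S)^+\},$$ is an operator system, the quotient operator system. The kernel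 $J$ is completely biproximinal if for all $n$ and $X\in M_n(\mathcal S)$ the norm of the class of $X$ in $M_n(\mathcal S/J)$, for the quotient operator system, equals $\inf\{\|X+Y\|: Y\in M_n(J)\}$. For a sequence $\mathcal S_1\xrightarrow{\phi_1}\mathcal S_2\xrightarrow{\phi_2}\cdots$ of operator systems and unital completely positive maps, let $\ddot{\mathcal S}_\infty$ be the space of the sequences $(x_k)\in\prod_k\mathcal S_k$ with $\phi_k(x_k)=x_{k+1}$ for all large $k$, modulo those that are eventually zero, with the induced involution and unit, and with $M_n(\ddot{\mathcal S}_\infty)^+$ the union over $k$ of the images of $M_n(\mathcal S_k)^+$ under the canonical maps. The inductive limit $\varinjlim\mathcal S_k$ is the Archimedeanisation of $\ddot{\mathcal S}_\infty$: the quotient of $\ddot{\mathcal S}_\infty$ by the subspace $N$ of the elements annihilated by all states, a hermitian matrix $X+M_n(N)$ being positive if $re^{(n)}+X\in M_n(\ddot{\mathcal S}_\infty)^++M_n(N)$ for all $r>0$. Let $\phi_{k,\infty}:\mathcal S_k\to\varinjlim\mathcal S_k$ be the canonical maps. Theorem. Let $\mathcal S_1\xrightarrow{\phi_1}\mathcal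 S_2\xrightarrow{\phi_2}\cdots$ be a sequence of operator systems and unital completely positive maps, and for each $k$ let $J_k$ be a completely biproximinal kernel in $\mathcal S_k$, such that $\phi_k(J_k)\subseteq J_{k+1}$. Let $q_k:\mathcal S_k\to\mathcal S_k/J_k$ be the quotient maps, let $\psi_k:\mathcal S_k/J_k\to\mathcal S_{k+1}/J_{k+1}$ be the unital completely positive maps with $\psi_k\circ q_k=q_{k+1}\circ\phi_k$, and let $\psi_{k,\infty}:\mathcal S_k/J_k\to\varinjlim(\mathcal S_k/J_k)$ be the canonical maps. Then the norm closure $\varinjlim J_k:=\overline{\bigcup_k\phi_{k,\infty}(J_k)}$ is a kernel in $\varinjlim\mathcal S_k$, and, with $\gamma:\varinjlim\mathcal S_k\to(\varinjlim\mathcal S_k)/(\varinjlim J_k)$ the quotient map, there is a unital complete order isomorphism $$\rho:\varinjlim(\mathcal S_k/J_k)\to(\varinjlim\mathcal S_k)/(\varinjlim J_k)$$ (a unital linear bijection such that $\rho$ and $\rho^{-1}$ are completely positive) such that $\rho\circ\psi_{k,\infty}\circ q_k=\gamma\circ\phi_{k,\infty}$ for every $k$. -/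

import Mathlib

universe u

namespace OpSys

open Matrix

/-! ## Matrices over a complex vector space -/

section Matrices

variable {V W : Type*} [AddCommGroup V] [Module ℂ V] [AddCommGroup W] [Module ℂ W]

/-- The compression `α* X α ∈ M_m(V)` of `X ∈ M_n(V)` by a scalar matrix `α ∈ M_{n,m}`. -/
def compress {n m : ℕ} (α : Matrix (Fin n) (Fin m) ℂ) (X : Matrix (Fin n) (Fin n) V) :
    Matrix (Fin m) (Fin m) V :=
  Matrix.of fun i j => ∑ k, ∑ l, (star (α k i) * α l j) • X k l

/-- `r e^{(n)}`: the diagonal `n × n` matrix with all diagonal entries equal to `r e`. -/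
def diagUnit (n : ℕ) (e : V) (r : ℝ) : Matrix (Fin n) (Fin n) V :=
  Matrix.diagonal fun _ => (r : ℂ) • e

theorem diagUnit_add (n : ℕ) (e : V) (r s : ℝ) :
    diagUnit n e (r + s) = diagUnit n e r + diagUnit n e s := by
  simp [diagUnit, Matrix.diagonal_add, add_smul]

theorem smul_diagUnit (n : ℕ) (e : V) (r s : ℝ) :
    (r : ℂ) • diagUnit n e s = diagUnit n e (r * s) := by
  ext i j
  by_cases h : i = j <;> simp [diagUnit, h, mul_smul]

theorem compress_map {n m : ℕ} (α : Matrix (Fin n) (Fin m) ℂ) (X : Matrix (Fin n) (Fin n) V)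
    (f : V →ₗ[ℂ] W) : compress α (X.map f) = (compress α X).map f := by
  ext i j
  simp [compress, map_sum]

theorem compress_add {n m : ℕ} (α : Matrix (Fin n) (Fin m) ℂ) (X Y : Matrix (Fin n) (Fin n) V) :
    compress α (X + Y) = compress α X + compress α Y := by
  ext i j
  simp [compress, Finset.sum_add_distrib]

theorem compress_smul {n m : ℕ} (α : Matrix (Fin n) (Fin m) ℂ) (c : ℂ)
    (X : Matrix (Fin n) (Fin n) V) : compress α (c • X) = c • compress α X := by
  ext i j
  simp only [compress, of_apply, Matrix.smul_apply, Finset.smul_sum]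
  refine Finset.sum_congr rfl fun k _ => Finset.sum_congr rfl fun l _ => ?_
  rw [smul_comm]

theorem compress_diagonal {n : ℕ} (d : Fin n → ℂ) (X : Matrix (Fin n) (Fin n) V) (i j : Fin n) :
    compress (Matrix.diagonal d) X i j = (star (d i) * d j) • X i j := by
  simp only [compress, of_apply]
  rw [Finset.sum_eq_single i, Finset.sum_eq_single j]
  · simp
  · intro b _ hb
    simp [hb]
  · simp
  · intro b _ hb
    refine Finset.sum_eq_zero fun l _ => ?_
    simp [Matrix.diagonal_apply, hb]
  · simp

theorem map_diagUnit (n : ℕ) (e : V) (r : ℝ) (f : V →ₗ[ℂ] W) :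
    (diagUnit n e r).map f = diagUnit n (f e) r := by
  ext i j
  by_cases h : i = j <;> simp [diagUnit, h]

end Matrices

/-! ## Matrix ordered *-vector spaces, operator systems, unital completely positive maps -/

/-- A matrix ordered *-vector space with a matrix order unit `e`. The set `cone n` is the cone
`C_n = M_n(S)⁺` of hermitian matrices. -/
structure MOUSpace where
  carrier : Type u
  [addCommGroup : AddCommGroup carrier]
  [module : Module ℂ carrier]
  [starAddMonoid : StarAddMonoid carrier]
  [starModule : StarModule ℂ carrier]
  cone : ∀ n : ℕ, Set (Matrix (Fin n) (Fin n) carrier)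
  unit : carrier
  cone_hermitian : ∀ n, ∀ X ∈ cone n, X.IsHermitian
  cone_add : ∀ n, ∀ X ∈ cone n, ∀ Y ∈ cone n, X + Y ∈ cone n
  cone_smul : ∀ n, ∀ X ∈ cone n, ∀ r : ℝ, 0 ≤ r → (r : ℂ) • X ∈ cone n
  cone_proper : ∀ n, ∀ X ∈ cone n, -X ∈ cone n → X = 0
  cone_compress : ∀ n m, ∀ α : Matrix (Fin n) (Fin m) ℂ, ∀ X ∈ cone n, compress α X ∈ cone m
  unit_mem : ∀ n, diagUnit n unit 1 ∈ cone n
  order_unit : ∀ n, ∀ X : Matrix (Fin n) (Fin n) carrier, X.IsHermitian →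
    ∃ r : ℝ, 0 < r ∧ diagUnit n unit r - X ∈ cone n

instance : CoeSort MOUSpace.{u} (Type u) := ⟨MOUSpace.carrier⟩

attribute [instance] MOUSpace.addCommGroup MOUSpace.module MOUSpace.starAddMonoid
  MOUSpace.starModule

/-- An (abstract) operator system: a matrix ordered *-vector space with an Archimedean matrix
order unit. -/
structure OperatorSystem extends MOUSpace.{u} where
  archimedean : ∀ n, ∀ X : Matrix (Fin n) (Fin n) carrier, X.IsHermitian →
    (∀ r : ℝ, 0 < r → diagUnit n unit r + X ∈ cone n) → X ∈ cone n

instance : CoeSort OperatorSystem.{u} (Type u) := ⟨fun S => S.carrier⟩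

instance : CoeOut OperatorSystem.{u} MOUSpace.{u} := ⟨OperatorSystem.toMOUSpace⟩

/-- A linear map is completely positive if all its amplifications preserve the cones. -/
def IsCompletelyPositive {S T : MOUSpace.{u}} (f : S →ₗ[ℂ] T) : Prop :=
  ∀ n, ∀ X ∈ S.cone n, X.map f ∈ T.cone n

/-- Unital completely positive maps, the morphisms between matrix ordered *-vector spaces with
matrix order units, and between operator systems. -/
structure UCPMap (S T : MOUSpace.{u}) where
  toLin : S →ₗ[ℂ] T
  map_unit : toLin S.unit = T.unit
  cp : IsCompletelyPositive toLin

/-- A unital complete order isomorphism: a linear bijection, unital and completely positive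
with completely positive inverse. -/
def IsUnitalCompleteOrderIso {S T : MOUSpace.{u}} (f : S ≃ₗ[ℂ] T) : Prop :=
  f S.unit = T.unit ∧ IsCompletelyPositive f.toLinearMap ∧ IsCompletelyPositive f.symm.toLinearMap

section Basic

variable (S : MOUSpace.{u})

theorem diagUnit_mem (n : ℕ) {r : ℝ} (hr : 0 ≤ r) : diagUnit n S.unit r ∈ S.cone n := by
  have := S.cone_smul n _ (S.unit_mem n) r hr
  rwa [smul_diagUnit, mul_one] at this

theorem zero_mem_cone (n : ℕ) : (0 : Matrix (Fin n) (Fin n) S) ∈ S.cone n := by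
  simpa using S.cone_smul n _ (S.unit_mem n) 0 le_rfl

theorem diagUnit_hermitian (n : ℕ) (r : ℝ) : (diagUnit n S.unit r).IsHermitian := by
  have := S.cone_hermitian n _ (S.unit_mem n)
  have h2 : ((r : ℂ) • diagUnit n S.unit 1).IsHermitian := by
    unfold Matrix.IsHermitian at *
    rw [Matrix.conjTranspose_smul, this]
    simp
  rwa [smul_diagUnit, mul_one] at h2

theorem compress_diagUnit_le {n m : ℕ} (α : Matrix (Fin n) (Fin m) ℂ) :
    ∃ r : ℝ, 0 < r ∧ diagUnit m S.unit r - compress α (diagUnit n S.unit 1) ∈ S.cone m :=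
  S.order_unit m _ (S.cone_hermitian m _ (S.cone_compress n m α _ (S.unit_mem n)))

end Basic

theorem one_hermitian {S : MOUSpace.{u}} {x : S} :
    (Matrix.of fun (_ _ : Fin 1) => x).IsHermitian ↔ star x = x := by
  constructor
  · intro h
    simpa using congrFun (congrFun h 0) 0
  · intro h
    ext i j
    simpa using h

/-- A linear map that maps `C_1` to selfadjoint elements is selfadjoint. -/
theorem map_star_of_pos {S : MOUSpace.{u}} {W : Type*} [AddCommGroup W] [Module ℂ W]
    [StarAddMonoid W] [StarModule ℂ W] (f : S →ₗ[ℂ] W)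
    (hf : ∀ x : S, (Matrix.of fun (_ _ : Fin 1) => x) ∈ S.cone 1 → star (f x) = f x) (x : S) :
    f (star x) = star (f x) := by
  have key : ∀ y : S, star y = y → star (f y) = f y := by
    intro y hy
    obtain ⟨r, hr, hm⟩ := S.order_unit 1 _ (one_hermitian.2 hy)
    have h1 := diagUnit_mem S 1 hr.le
    have e1 : diagUnit 1 S.unit r = Matrix.of fun (_ _ : Fin 1) => (r : ℂ) • S.unit := by
      ext i j
      simp [diagUnit, Subsingleton.elim i j]
    have e2 : diagUnit 1 S.unit r - (Matrix.of fun (_ _ : Fin 1) => y)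
        = Matrix.of fun (_ _ : Fin 1) => (r : ℂ) • S.unit - y := by
      rw [e1]; ext i j; simp
    rw [e1] at h1
    rw [e2] at hm
    have h3 := hf _ h1
    have h4 := hf _ hm
    have h5 : y = (r : ℂ) • S.unit - ((r : ℂ) • S.unit - y) := by abel
    rw [h5, map_sub, star_sub, h3, h4]
  set a : S := x + star x with ha
  set b : S := Complex.I • (x - star x) with hb
  have hsa : star a = a := by simp [ha, add_comm]
  have hsb : star b = b := by
    simp only [hb, star_smul, star_sub, star_star, RCLike.star_def, Complex.conj_I]
    rw [neg_smul, ← smul_neg, neg_sub]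
  have h1 := key a hsa
  have h2 := key b hsb
  simp only [ha, map_add, star_add] at h1
  simp only [hb, map_smul, map_sub, star_smul, star_sub, RCLike.star_def, Complex.conj_I,
    neg_smul] at h2
  rw [← smul_neg] at h2
  have h3 := smul_right_injective W Complex.I_ne_zero h2
  have h4 : (2 : ℂ) • f (star x) = (2 : ℂ) • star (f x) := by
    rw [two_smul, two_smul]
    have h5 : f (star x) = star (f x) + star (f (star x)) - f x := by rw [h1]; abel
    have h6 : f (star x) = f x + star (f x) - star (f (star x)) := by
      refine sub_eq_zero.1 (Eq.trans ?_ (sub_eq_zero.2 h3))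
      abel
    calc f (star x) + f (star x)
        = (star (f x) + star (f (star x)) - f x) + (f x + star (f x) - star (f (star x))) := by
          rw [← h5, ← h6]
      _ = star (f x) + star (f x) := by abel
  exact smul_right_injective W two_ne_zero h4

namespace UCPMap

variable {S T R : MOUSpace.{u}}

def id (S : MOUSpace.{u}) : UCPMap S S where
  toLin := LinearMap.id
  map_unit := rfl
  cp := fun n X hX => by
    have : X.map (LinearMap.id : S →ₗ[ℂ] S) = X := by ext; simp
    rwa [this]

def comp (g : UCPMap T R) (f : UCPMap S T) : UCPMap S R where
  toLin := g.toLin ∘ₗ f.toLin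
  map_unit := by simp [f.map_unit, g.map_unit]
  cp := fun n X hX => by
    have := g.cp n _ (f.cp n X hX)
    rwa [Matrix.map_map] at this

theorem map_star (f : UCPMap S T) (x : S) : f.toLin (star x) = star (f.toLin x) := by
  refine map_star_of_pos f.toLin (fun y hy => ?_) x
  have h := T.cone_hermitian 1 _ (f.cp 1 _ hy)
  simpa using congrFun (congrFun h 0) 0

end UCPMap

/-! ## The matrix norms -/

/-- The `2n × 2n` matrix `[[r e^{(n)}, X], [X*, r e^{(n)}]]`. -/
def normBlock (S : MOUSpace.{u}) {n : ℕ} (r : ℝ) (X : Matrix (Fin n) (Fin n) S) :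
    Matrix (Fin (n + n)) (Fin (n + n)) S :=
  Matrix.reindex finSumFinEquiv finSumFinEquiv
    (Matrix.fromBlocks (diagUnit n S.unit r) X Xᴴ (diagUnit n S.unit r))

/-- The norm of `X ∈ M_n(S)`: the least `r ≥ 0` such that
`[[r e^{(n)}, X], [X*, r e^{(n)}]] ∈ M_{2n}(S)⁺`. -/
noncomputable def opNorm (S : MOUSpace.{u}) {n : ℕ} (X : Matrix (Fin n) (Fin n) S) : ℝ :=
  sInf {r : ℝ | 0 ≤ r ∧ normBlock S r X ∈ S.cone (n + n)}

/-- The norm of an element `x` of `S = M_1(S)`. -/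
noncomputable def elemNorm (S : MOUSpace.{u}) (x : S) : ℝ :=
  opNorm S (Matrix.of fun (_ _ : Fin 1) => x)

section Norm

variable (S : MOUSpace.{u}) {n : ℕ}

theorem normBlock_add (r s : ℝ) (X Y : Matrix (Fin n) (Fin n) S) :
    normBlock S (r + s) (X + Y) = normBlock S r X + normBlock S s Y := by
  unfold normBlock
  rw [diagUnit_add, Matrix.conjTranspose_add, ← Matrix.fromBlocks_add]
  rfl

theorem normBlock_zero (r : ℝ) :
    normBlock S r (0 : Matrix (Fin n) (Fin n) S) = diagUnit (n + n) S.unit r := by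
  unfold normBlock diagUnit
  rw [Matrix.conjTranspose_zero, Matrix.fromBlocks_diagonal]
  ext i j
  simp [Matrix.diagonal_apply]

theorem normBlock_hermitian (X : Matrix (Fin n) (Fin n) S) : (normBlock S 0 X).IsHermitian := by
  unfold normBlock Matrix.IsHermitian
  rw [Matrix.conjTranspose_reindex, Matrix.fromBlocks_conjTranspose,
    (diagUnit_hermitian S n 0), Matrix.conjTranspose_conjTranspose]

theorem opNorm_set_nonempty (X : Matrix (Fin n) (Fin n) S) :
    {r : ℝ | 0 ≤ r ∧ normBlock S r X ∈ S.cone (n + n)}.Nonempty := by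
  obtain ⟨r, hr, h⟩ := S.order_unit (n + n) _ (normBlock_hermitian S (-X))
  refine ⟨r, hr.le, ?_⟩
  have h2 : normBlock S r X = diagUnit (n + n) S.unit r - normBlock S 0 (-X) := by
    rw [eq_sub_iff_add_eq, ← normBlock_add, add_zero, add_neg_cancel, normBlock_zero]
  rwa [h2]

theorem opNorm_le {r : ℝ} (hr : 0 ≤ r) {X : Matrix (Fin n) (Fin n) S}
    (h : normBlock S r X ∈ S.cone (n + n)) : opNorm S X ≤ r :=
  csInf_le ⟨0, fun _ hs => hs.1⟩ ⟨hr, h⟩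

theorem exists_of_opNorm_lt {ε : ℝ} {X : Matrix (Fin n) (Fin n) S} (h : opNorm S X < ε) :
    ∃ r, 0 ≤ r ∧ r < ε ∧ normBlock S r X ∈ S.cone (n + n) := by
  obtain ⟨r, ⟨h0, h1⟩, h2⟩ := exists_lt_of_csInf_lt (opNorm_set_nonempty S X) h
  exact ⟨r, h0, h2, h1⟩

theorem opNorm_zero : opNorm S (0 : Matrix (Fin n) (Fin n) S) ≤ 0 := by
  refine opNorm_le S le_rfl ?_
  rw [normBlock_zero]
  exact diagUnit_mem S _ le_rfl

theorem opNorm_add_lt {X Y : Matrix (Fin n) (Fin n) S} {a b : ℝ} (hX : opNorm S X < a)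
    (hY : opNorm S Y < b) : opNorm S (X + Y) < a + b := by
  obtain ⟨r, hr, hra, h1⟩ := exists_of_opNorm_lt S hX
  obtain ⟨s, hs, hsb, h2⟩ := exists_of_opNorm_lt S hY
  refine lt_of_le_of_lt (opNorm_le S (add_nonneg hr hs) ?_) (add_lt_add hra hsb)
  rw [normBlock_add]
  exact S.cone_add _ _ h1 _ h2

theorem opNorm_smul_lt {c : ℂ} (hc : c ≠ 0) {X : Matrix (Fin n) (Fin n) S} {a : ℝ}
    (hX : opNorm S X < a) : opNorm S (c • X) < ‖c‖ * a := by
  obtain ⟨r, hr, hra, h1⟩ := exists_of_opNorm_lt S hX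
  have hc' : 0 < ‖c‖ := norm_pos_iff.2 hc
  refine lt_of_le_of_lt (opNorm_le S (mul_nonneg hc'.le hr) ?_) (mul_lt_mul_of_pos_left hra hc')
  set p : ℝ := Real.sqrt ‖c‖ with hp
  have hpp : p * p = ‖c‖ := Real.mul_self_sqrt hc'.le
  have hp0 : (p : ℂ) ≠ 0 := by
    have : 0 < p := Real.sqrt_pos.2 hc'
    exact_mod_cast this.ne'
  have hppc : (p : ℂ) * p = (‖c‖ : ℂ) := by exact_mod_cast hpp
  let d : Fin n ⊕ Fin n → ℂ := Sum.elim (fun _ => (p : ℂ)) (fun _ => c / p)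
  have h2 := S.cone_compress _ _ (Matrix.diagonal (d ∘ finSumFinEquiv.symm)) _ h1
  have h3 : compress (Matrix.diagonal (d ∘ finSumFinEquiv.symm)) (normBlock S r X)
      = normBlock S (‖c‖ * r) (c • X) := by
    ext i j
    rw [compress_diagonal]
    obtain ⟨i, rfl⟩ := finSumFinEquiv.surjective i
    obtain ⟨j, rfl⟩ := finSumFinEquiv.surjective j
    have hsp : star (p : ℂ) = p := Complex.conj_ofReal p
    have hcc : star (c / (p : ℂ)) * (c / p) = (‖c‖ : ℂ) := by
      rw [star_div₀, hsp, div_mul_div_comm, hppc, div_eq_iff (by exact_mod_cast hc'.ne')]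
      exact (Complex.conj_mul' c).trans (sq _)
    have hpc : (p : ℂ) * (c / p) = c := mul_div_cancel₀ c hp0
    have hcp : star (c / (p : ℂ)) * p = star c := by
      rw [star_div₀, hsp, div_mul_cancel₀ _ hp0]
    rcases i with i | i <;> rcases j with j | j <;>
      simp only [normBlock, d, Function.comp, Equiv.symm_apply_apply, Sum.elim_inl, Sum.elim_inr,
        hcp, hcc, hpc, hsp, hppc, Matrix.reindex_apply, Matrix.submatrix_apply,
        Matrix.fromBlocks_apply₁₁, Matrix.fromBlocks_apply₁₂, Matrix.fromBlocks_apply₂₁,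
        Matrix.fromBlocks_apply₂₂, Matrix.conjTranspose_smul, Matrix.smul_apply,
        ← smul_diagUnit]
  rwa [h3] at h2

/-- The closure of a linear subspace of `S` in the norm of `S`. -/
noncomputable def normClosure (U : Submodule ℂ S) : Submodule ℂ S where
  carrier := {x | ∀ ε : ℝ, 0 < ε → ∃ y ∈ U, elemNorm S (x - y) < ε}
  zero_mem' := fun ε hε => ⟨0, U.zero_mem, by
    have h : (Matrix.of fun (_ _ : Fin 1) => (0 : S) - 0) = 0 := by ext; simp
    unfold elemNorm
    rw [h]
    exact (opNorm_zero S).trans_lt hε⟩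
  add_mem' := by
    intro x x' hx hx' ε hε
    obtain ⟨y, hy, h⟩ := hx (ε / 2) (half_pos hε)
    obtain ⟨y', hy', h'⟩ := hx' (ε / 2) (half_pos hε)
    refine ⟨y + y', U.add_mem hy hy', ?_⟩
    have := opNorm_add_lt S h h'
    rw [add_halves] at this
    unfold elemNorm
    convert this using 2
    ext i j
    simp only [Matrix.of_apply, Matrix.add_apply]
    abel
  smul_mem' := by
    intro c x hx ε hε
    by_cases hc : c = 0
    · refine ⟨0, U.zero_mem, ?_⟩
      have h : (Matrix.of fun (_ _ : Fin 1) => c • x - 0) = 0 := by ext; simp [hc]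
      unfold elemNorm
      rw [h]
      exact (opNorm_zero S).trans_lt hε
    · have hc' : 0 < ‖c‖ := norm_pos_iff.2 hc
      obtain ⟨y, hy, h⟩ := hx (ε / ‖c‖) (div_pos hε hc')
      refine ⟨c • y, U.smul_mem c hy, ?_⟩
      have := opNorm_smul_lt S hc h
      rw [mul_div_cancel₀ _ hc'.ne'] at this
      unfold elemNorm
      convert this using 2
      ext i j
      simp [smul_sub]

end Norm

/-! ## Quotients of matrix ordered *-vector spaces -/

section QuotStar

variable {V : Type*} [AddCommGroup V] [Module ℂ V] [StarAddMonoid V] [StarModule ℂ V]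

/-- The involution `(x + J)* = x* + J` on `V ⧸ J`, for a selfadjoint subspace `J`. -/
abbrev quotStar (J : Submodule ℂ V) (hJ : ∀ x ∈ J, star x ∈ J) : StarAddMonoid (V ⧸ J) where
  star := Quotient.map' star (by
    intro a b h
    rw [Submodule.quotientRel_def] at h ⊢
    rw [← star_sub]
    exact hJ _ h)
  star_involutive := by
    intro x
    induction x using Submodule.Quotient.induction_on with
    | H x => exact congrArg Submodule.Quotient.mk (star_star x)
  star_add := by
    intro x y
    induction x using Submodule.Quotient.induction_on with
    | H x =>
      induction y using Submodule.Quotient.induction_on with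
      | H y => exact congrArg Submodule.Quotient.mk (star_add x y)

theorem quotStarModule (J : Submodule ℂ V) (hJ : ∀ x ∈ J, star x ∈ J) :
    letI := quotStar J hJ
    StarModule ℂ (V ⧸ J) := by
  let _ := quotStar J hJ
  refine ⟨fun c x => ?_⟩
  induction x using Submodule.Quotient.induction_on with
  | H x => exact congrArg Submodule.Quotient.mk (star_smul c x)

end QuotStar

/-- The cones on `S ⧸ J`: a matrix `(x_{ij} + J)` belongs to the `n`-th one if for every `r > 0`
it has a representative `Y = (x_{ij} + k_{ij})`, with `k_{ij} ∈ J`, such that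
`r e^{(n)} + Y ∈ M_n(S)⁺`. -/
def quotCone (S : MOUSpace.{u}) (J : Submodule ℂ S) (n : ℕ) :
    Set (Matrix (Fin n) (Fin n) (S ⧸ J)) :=
  {X | ∀ r : ℝ, 0 < r → ∃ Y : Matrix (Fin n) (Fin n) S, Y.map J.mkQ = X ∧
    diagUnit n S.unit r + Y ∈ S.cone n}

/-- The properties of a subspace `J` under which the cones `quotCone` turn `S ⧸ J` into an operator
system: `J` is selfadjoint and the cones are proper. They are proved below for the two
subspaces that are factored out: null spaces and kernels. -/
structure IsNullSubspace (S : MOUSpace.{u}) (J : Submodule ℂ S) : Prop where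
  star_mem : ∀ x ∈ J, star x ∈ J
  proper : ∀ n, ∀ X : Matrix (Fin n) (Fin n) (S ⧸ J),
    X ∈ quotCone S J n → -X ∈ quotCone S J n → X = 0

theorem exists_rep {S : MOUSpace.{u}} (J : Submodule ℂ S) {n : ℕ}
    (X : Matrix (Fin n) (Fin n) (S ⧸ J)) : ∃ Y : Matrix (Fin n) (Fin n) S, Y.map J.mkQ = X := by
  refine ⟨Matrix.of fun i j => (J.mkQ_surjective (X i j)).choose, ?_⟩
  ext i j
  exact (J.mkQ_surjective (X i j)).choose_spec

/-- The operator system `S ⧸ J` with the quotient involution, the cones `quotCone S J n` and the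
unit `e + J`. -/
def quotSystem (S : MOUSpace.{u}) (J : Submodule ℂ S) (hJ : IsNullSubspace S J) :
    OperatorSystem.{u} :=
  letI := quotStar J hJ.star_mem
  haveI := quotStarModule J hJ.star_mem
  { carrier := S ⧸ J
    cone := quotCone S J
    unit := J.mkQ S.unit
    cone_hermitian := by
      intro n X hX
      obtain ⟨Y, rfl, hY⟩ := hX 1 one_pos
      have h1 := S.cone_hermitian n _ hY
      have h2 : Y.IsHermitian := by
        have := h1.sub (diagUnit_hermitian S n 1)
        simpa using this
      ext i j
      exact congrArg J.mkQ (congrFun (congrFun h2 i) j)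
    cone_add := by
      intro n X hX X' hX' r hr
      obtain ⟨Y, rfl, hY⟩ := hX (r / 2) (half_pos hr)
      obtain ⟨Y', rfl, hY'⟩ := hX' (r / 2) (half_pos hr)
      refine ⟨Y + Y', by ext; simp, ?_⟩
      have := S.cone_add n _ hY _ hY'
      have e : diagUnit n S.unit r + (Y + Y')
          = (diagUnit n S.unit (r / 2) + Y) + (diagUnit n S.unit (r / 2) + Y') := by
        conv_lhs => rw [← add_halves r, diagUnit_add]
        abel
      rwa [e]
    cone_smul := by
      intro n X hX t ht r hr
      rcases ht.eq_or_lt with rfl | ht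
      · refine ⟨0, by ext; simp, ?_⟩
        rw [add_zero]
        exact diagUnit_mem S n hr.le
      · obtain ⟨Y, rfl, hY⟩ := hX (r / t) (div_pos hr ht)
        refine ⟨(t : ℂ) • Y, by ext; simp, ?_⟩
        have := S.cone_smul n _ hY t ht.le
        rwa [smul_add, smul_diagUnit, mul_div_cancel₀ _ ht.ne'] at this
    cone_proper := hJ.proper
    cone_compress := by
      intro n m α X hX r hr
      obtain ⟨c, hc, hcm⟩ := compress_diagUnit_le S α
      obtain ⟨Y, rfl, hY⟩ := hX (r / c) (div_pos hr hc)
      refine ⟨compress α Y, (compress_map α Y J.mkQ).symm, ?_⟩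
      have h1 := S.cone_compress n m α _ hY
      have h2 := S.cone_smul m _ hcm (r / c) (div_pos hr hc).le
      have h3 := S.cone_add m _ h1 _ h2
      have e : compress α (diagUnit n S.unit (r / c) + Y) + ((r / c : ℝ) : ℂ) •
          (diagUnit m S.unit c - compress α (diagUnit n S.unit 1))
          = diagUnit m S.unit r + compress α Y := by
        rw [smul_sub, smul_diagUnit, div_mul_cancel₀ _ hc.ne', compress_add, ← compress_smul,
          smul_diagUnit, mul_one]
        abel
      rwa [e] at h3
    unit_mem := by
      intro n r hr
      refine ⟨diagUnit n S.unit 1, map_diagUnit _ _ _ _, ?_⟩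
      rw [← diagUnit_add]
      exact diagUnit_mem S n (by linarith)
    order_unit := by
      intro n X hX
      obtain ⟨Y, rfl⟩ := exists_rep J X
      obtain ⟨r, hr, h⟩ := S.order_unit n ((1 / 2 : ℂ) • (Y + Yᴴ)) (by
        unfold Matrix.IsHermitian
        rw [Matrix.conjTranspose_smul, Matrix.conjTranspose_add,
          Matrix.conjTranspose_conjTranspose, add_comm]
        simp)
      refine ⟨r, hr, fun s hs => ⟨diagUnit n S.unit r - (1 / 2 : ℂ) • (Y + Yᴴ), ?_, ?_⟩⟩
      · have h1 : (Yᴴ).map J.mkQ = Y.map J.mkQ := by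
          ext i j
          exact congrFun (congrFun hX i) j
        have h2 : (diagUnit n S.unit r - (1 / 2 : ℂ) • (Y + Yᴴ)).map J.mkQ
            = (diagUnit n S.unit r).map J.mkQ
              - (1 / 2 : ℂ) • (Y.map J.mkQ + (Yᴴ).map J.mkQ) := by
          ext i j
          simp only [Matrix.map_apply, Matrix.sub_apply, Matrix.smul_apply, Matrix.add_apply,
            map_sub, map_smul, map_add]
        rw [h2, h1, map_diagUnit, ← two_smul ℂ, smul_smul]
        norm_num
      · exact S.cone_add n _ (diagUnit_mem S n hs.le) _ h
    archimedean := by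
      intro n X _ h r hr
      obtain ⟨Y, hY, hm⟩ := h (r / 2) (half_pos hr) (r / 2) (half_pos hr)
      refine ⟨Y - diagUnit n S.unit (r / 2), ?_, ?_⟩
      · have h2 : (Y - diagUnit n S.unit (r / 2)).map J.mkQ
            = Y.map J.mkQ - (diagUnit n S.unit (r / 2)).map J.mkQ := by
          ext i j
          simp only [Matrix.map_apply, Matrix.sub_apply, map_sub]
        rw [h2, hY, map_diagUnit]
        abel
      · have e : diagUnit n S.unit r + (Y - diagUnit n S.unit (r / 2))
            = diagUnit n S.unit (r / 2) + Y := by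
          conv_lhs => rw [← add_halves r, diagUnit_add]
          rw [add_halves]
          abel
        rwa [e] }

/-- The quotient map `S → S ⧸ J`. -/
def quotMap (S : MOUSpace.{u}) (J : Submodule ℂ S) (hJ : IsNullSubspace S J) :
    UCPMap S (quotSystem S J hJ) where
  toLin := J.mkQ
  map_unit := rfl
  cp := fun n X hX _ hr => ⟨X, rfl, S.cone_add n _ (diagUnit_mem S n hr.le) _ hX⟩

/-! ## Kernels, quotient operator systems, complete biproximinality -/

/-- A subspace `J` of an operator system `S` is a kernel if it is the kernel of a unital completely
positive map from `S` into an operator system. -/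
def IsKernel (S : OperatorSystem.{u}) (J : Submodule ℂ S) : Prop :=
  ∃ (T : OperatorSystem.{u}) (f : UCPMap S T), J = LinearMap.ker f.toLin

theorem IsKernel.isNull {S : OperatorSystem.{u}} {J : Submodule ℂ S} (h : IsKernel S J) :
    IsNullSubspace S.toMOUSpace J := by
  obtain ⟨T, f, rfl⟩ := h
  refine ⟨fun x hx => ?_, fun n X h1 h2 => ?_⟩
  · rw [LinearMap.mem_ker] at hx ⊢
    rw [f.map_star, hx, star_zero]
  · obtain ⟨Y, rfl⟩ := exists_rep _ X
    have key : ∀ Z : Matrix (Fin n) (Fin n) S,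
        Z.map (LinearMap.ker f.toLin).mkQ ∈ quotCone S (LinearMap.ker f.toLin) n →
        Z.map f.toLin ∈ T.cone n := by
      intro Z hZ
      have aux : ∀ r : ℝ, 0 < r → diagUnit n T.unit r + Z.map f.toLin ∈ T.cone n := by
        intro r hr
        obtain ⟨W, hW, hm⟩ := hZ r hr
        have hWZ : W.map f.toLin = Z.map f.toLin := by
          ext i j
          have := congrFun (congrFun hW i) j
          simp only [Matrix.map_apply, Submodule.mkQ_apply, Submodule.Quotient.eq,
            LinearMap.mem_ker, map_sub, sub_eq_zero] at this
          exact this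
        have h3 := f.cp n _ hm
        have h4 : (diagUnit n S.unit r + W).map f.toLin
            = diagUnit n T.unit r + Z.map f.toLin := by
          rw [← hWZ, ← f.map_unit, ← map_diagUnit]
          ext i j
          simp only [Matrix.map_apply, Matrix.add_apply, map_add]
        rwa [h4] at h3
      refine T.archimedean n _ ?_ aux
      have := (T.cone_hermitian n _ (aux 1 one_pos)).sub (diagUnit_hermitian T.toMOUSpace n 1)
      simpa using this
    have k1 := key Y h1
    have k2 := key (-Y) (by
      have : (-Y).map (LinearMap.ker f.toLin).mkQ = -Y.map (LinearMap.ker f.toLin).mkQ := by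
        ext i j
        simp only [Matrix.map_apply, Matrix.neg_apply, map_neg]
      rwa [this])
    have k3 : (-Y).map f.toLin = -Y.map f.toLin := by
      ext i j
      simp only [Matrix.map_apply, Matrix.neg_apply, map_neg]
    rw [k3] at k2
    have k4 := T.cone_proper n _ k1 k2
    ext i j
    have := congrFun (congrFun k4 i) j
    simp only [Matrix.map_apply, Matrix.zero_apply] at this ⊢
    rw [Submodule.mkQ_apply, Submodule.Quotient.mk_eq_zero]
    exact this

/-- The quotient operator system `S / J` of an operator system by a kernel. -/
def quotient (S : OperatorSystem.{u}) (J : Submodule ℂ S) (hJ : IsKernel S J) :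
    OperatorSystem.{u} :=
  quotSystem S J hJ.isNull

/-- The quotient map `S → S / J`. -/
def quotient.proj (S : OperatorSystem.{u}) (J : Submodule ℂ S) (hJ : IsKernel S J) :
    UCPMap S (quotient S J hJ) :=
  quotMap S J hJ.isNull

/-- The operator space quotient norm of the class of `X` in `M_n(S / J) = M_n(S) / M_n(J)`. -/
noncomputable def quotNorm (S : OperatorSystem.{u}) (J : Submodule ℂ S) {n : ℕ}
    (X : Matrix (Fin n) (Fin n) S) : ℝ :=
  sInf {t : ℝ | ∃ Y : Matrix (Fin n) (Fin n) S, (∀ i j, Y i j ∈ J) ∧ t = opNorm S (X + Y)}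

/-- A kernel `J` is completely biproximinal if on all the spaces `M_n(S / J)` the norm of the
operator system quotient is the norm of the operator space quotient. -/
def IsCompletelyBiproximinal (S : OperatorSystem.{u}) (J : Submodule ℂ S)
    (hJ : IsKernel S J) : Prop :=
  ∀ (n : ℕ) (X : Matrix (Fin n) (Fin n) S),
    opNorm (quotient S J hJ).toMOUSpace (X.map (quotient.proj S J hJ).toLin) = quotNorm S J X

/-- The map `S / J → T / K` induced by a unital completely positive map `f : S → T` with
`f(J) ⊆ K`. -/
def quotient.map {S T : OperatorSystem.{u}} (f : UCPMap S T) {J : Submodule ℂ S}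
    {K : Submodule ℂ T} (hJ : IsKernel S J) (hK : IsKernel T K)
    (h : J.map f.toLin ≤ K) : UCPMap (quotient S J hJ) (quotient T K hK) where
  toLin := J.mapQ K f.toLin (Submodule.map_le_iff_le_comap.1 h)
  map_unit := congrArg K.mkQ f.map_unit
  cp := by
    intro n X hX r hr
    obtain ⟨Y, rfl, hY⟩ := hX r hr
    refine ⟨Y.map f.toLin, by ext i j; rfl, ?_⟩
    have := f.cp n _ hY
    have e : (diagUnit n S.unit r + Y).map f.toLin
        = diagUnit n T.unit r + Y.map f.toLin := by
      rw [← f.map_unit, ← map_diagUnit]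
      ext i j
      simp only [Matrix.map_apply, Matrix.add_apply, map_add]
    rwa [e] at this

/-! ## Archimedeanisation -/

/-- A state of `S`: a unital positive functional. -/
structure IsState (S : MOUSpace.{u}) (f : S →ₗ[ℂ] ℂ) : Prop where
  map_unit : f S.unit = 1
  nonneg : ∀ x : S, (Matrix.of fun (_ _ : Fin 1) => x) ∈ S.cone 1 → 0 ≤ (f x).re ∧ (f x).im = 0

/-- The null space of `S`: the elements annihilated by all the states. -/
def nullSpace (S : MOUSpace.{u}) : Submodule ℂ S where
  carrier := {x | ∀ f : S →ₗ[ℂ] ℂ, IsState S f → f x = 0}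
  zero_mem' := fun f _ => map_zero f
  add_mem' := fun hx hy f hf => by rw [map_add, hx f hf, hy f hf, add_zero]
  smul_mem' := fun c x hx f hf => by rw [map_smul, hx f hf, smul_zero]

theorem nullSpace_isNull (S : MOUSpace.{u}) : IsNullSubspace S (nullSpace S) := by
  refine ⟨fun x hx f hf => ?_, fun n X h1 h2 => ?_⟩
  · rw [map_star_of_pos f (fun y hy => Complex.conj_eq_iff_im.2 (hf.nonneg y hy).2), hx f hf,
      star_zero]
  · obtain ⟨Y, rfl⟩ := exists_rep _ X
    have key : ∀ f : S →ₗ[ℂ] ℂ, IsState S f → ∀ v : Matrix (Fin n) (Fin 1) ℂ,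
        ∀ Z : Matrix (Fin n) (Fin n) S, Z.map (nullSpace S).mkQ ∈ quotCone S (nullSpace S) n →
        0 ≤ (f (compress v Z 0 0)).re ∧ (f (compress v Z 0 0)).im = 0 := by
      intro f hf v Z hZ
      have pos1 : ∀ P : Matrix (Fin n) (Fin n) S, P ∈ S.cone n →
          0 ≤ (f (compress v P 0 0)).re ∧ (f (compress v P 0 0)).im = 0 := by
        intro P hP
        refine hf.nonneg _ ?_
        have h := S.cone_compress n 1 v P hP
        convert h using 1
        ext i j
        rw [Subsingleton.elim i 0, Subsingleton.elim j 0]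
        rfl
      have aux : ∀ r : ℝ, 0 < r →
          0 ≤ r * (f (compress v (diagUnit n S.unit 1) 0 0)).re + (f (compress v Z 0 0)).re ∧
          (f (compress v Z 0 0)).im = 0 := by
        intro r hr
        obtain ⟨W, hW, hm⟩ := hZ r hr
        have hWZ : f (compress v W 0 0) = f (compress v Z 0 0) := by
          simp only [compress, Matrix.of_apply, map_sum, map_smul]
          refine Finset.sum_congr rfl fun k _ => Finset.sum_congr rfl fun l _ => ?_
          have := congrFun (congrFun hW k) l
          simp only [Matrix.map_apply, Submodule.mkQ_apply, Submodule.Quotient.eq] at this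
          have h3 := this f hf
          rw [map_sub, sub_eq_zero] at h3
          rw [h3]
        have h4 := pos1 _ hm
        have h5 := pos1 _ (S.unit_mem n)
        have e : diagUnit n S.unit r = (r : ℂ) • diagUnit n S.unit 1 := by
          rw [smul_diagUnit, mul_one]
        rw [e, compress_add, compress_smul, Matrix.add_apply, Matrix.smul_apply, map_add,
          map_smul, hWZ] at h4
        simp only [smul_eq_mul, Complex.add_re, Complex.add_im, Complex.re_ofReal_mul,
          Complex.im_ofReal_mul, h5.2, mul_zero, zero_add] at h4
        exact h4
      refine ⟨?_, (aux 1 one_pos).2⟩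
      by_contra hneg
      push Not at hneg
      set a := (f (compress v (diagUnit n S.unit 1) 0 0)).re
      set b := (f (compress v Z 0 0)).re
      have ha : 0 < |a| + 1 := by positivity
      have h6 := (aux (-b / (2 * (|a| + 1))) (by apply div_pos <;> linarith)).1
      have h7 : -b / (2 * (|a| + 1)) * a ≤ -b / 2 := by
        rw [div_mul_eq_mul_div, div_le_div_iff₀ (by positivity) two_pos]
        nlinarith [le_abs_self a]
      linarith
    have zero : ∀ f : S →ₗ[ℂ] ℂ, IsState S f → ∀ v : Matrix (Fin n) (Fin 1) ℂ,
        f (compress v Y 0 0) = 0 := by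
      intro f hf v
      have k1 := key f hf v Y h1
      have k2 := key f hf v (-Y) (by
        have : (-Y).map (nullSpace S).mkQ = -Y.map (nullSpace S).mkQ := by
          ext i j
          simp only [Matrix.map_apply, Matrix.neg_apply, map_neg]
        rwa [this])
      have e : compress v (-Y) = -compress v Y := by
        rw [← neg_one_smul ℂ Y, compress_smul, neg_one_smul]
      rw [e, Matrix.neg_apply, map_neg, Complex.neg_re, Complex.neg_im] at k2
      apply Complex.ext
      · rw [Complex.zero_re]
        linarith [k1.1, k2.1]
      · exact k1.2
    ext i j
    simp only [Matrix.map_apply, Matrix.zero_apply]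
    rw [Submodule.mkQ_apply, Submodule.Quotient.mk_eq_zero]
    intro f hf
    have form : ∀ a b : ℂ, 0 = star a * a * f (Y i i) + star a * b * f (Y i j)
          + star b * a * f (Y j i) + star b * b * f (Y j j) := by
      intro a b
      rw [← zero f hf (Matrix.of fun k _ => (if k = i then a else 0) + (if k = j then b else 0))]
      simp only [compress, Matrix.of_apply, map_sum, map_smul, smul_eq_mul, star_add,
        apply_ite star, star_zero, add_mul, mul_add, Finset.sum_add_distrib, ite_mul, mul_ite,
        zero_mul, mul_zero, Finset.sum_ite_eq', Finset.mem_univ, if_true]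
      simp
      ring
    have h10 := form 1 0
    have h01 := form 0 1
    have h11 := form 1 1
    have h1i := form 1 Complex.I
    simp only [RCLike.star_def, map_one, map_zero, Complex.conj_I] at h10 h01 h11 h1i
    have hI := Complex.I_mul_I
    have hii : f (Y i i) = 0 := by linear_combination -h10
    have hjj : f (Y j j) = 0 := by linear_combination -h01
    rw [hii, hjj] at h11 h1i
    have g1 : f (Y i j) + f (Y j i) = 0 := by linear_combination -h11
    have g2 : Complex.I * (f (Y i j) - f (Y j i)) = 0 := by linear_combination -h1i
    have g3 := (mul_eq_zero.1 g2).resolve_left Complex.I_ne_zero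
    linear_combination (g1 + g3) / 2

/-- The Archimedeanisation of a matrix ordered *-vector space with matrix order unit: the quotient
by the null space. -/
def archimedeanisation (S : MOUSpace.{u}) : OperatorSystem.{u} :=
  quotSystem S (nullSpace S) (nullSpace_isNull S)

/-- The quotient map of a space onto its Archimedeanisation. -/
def archimedeanisation.proj (S : MOUSpace.{u}) : UCPMap S (archimedeanisation S) :=
  quotMap S (nullSpace S) (nullSpace_isNull S)

/-! ## Inductive limits -/

section Limit

variable {S : ℕ → MOUSpace.{u}} (φ : ∀ k, UCPMap (S k) (S (k + 1)))

/-- The maps `φ_{k,l} = φ_{l-1} ∘ ⋯ ∘ φ_k : S_k → S_l`, for `k ≤ l`. -/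
def transition {k l : ℕ} (h : k ≤ l) : UCPMap (S k) (S l) :=
  Nat.leRecOn (C := fun l => UCPMap (S k) (S l)) h (fun {l} f => (φ l).comp f) (UCPMap.id (S k))

theorem transition_self {k : ℕ} (x : S k) : (transition φ (le_refl k)).toLin x = x := by
  unfold transition
  rw [Nat.leRecOn_self]
  rfl

theorem transition_succ {k l : ℕ} (h : k ≤ l) (h' : k ≤ l + 1) (x : S k) :
    (transition φ h').toLin x = (φ l).toLin ((transition φ h).toLin x) := by
  unfold transition
  rw [Nat.leRecOn_succ h]
  rfl

theorem transition_trans {k l m : ℕ} (h : k ≤ l) (h' : l ≤ m) (x : S k) :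
    (transition φ (h.trans h')).toLin x = (transition φ h').toLin ((transition φ h).toLin x) := by
  induction m, h' using Nat.le_induction with
  | base => rw [transition_self]
  | succ m hm ih => rw [transition_succ φ (h.trans hm), ih, transition_succ φ hm]

/-- The space of the sequences `(x_k)` with `φ_k(x_k) = x_{k+1}` for all sufficiently large `k`. -/
def coherentSeq : Submodule ℂ (∀ k, S k) where
  carrier := {x | ∃ m, ∀ k, m ≤ k → (φ k).toLin (x k) = x (k + 1)}
  zero_mem' := ⟨0, fun k _ => map_zero _⟩
  add_mem' := by
    rintro x y ⟨m, hm⟩ ⟨m', hm'⟩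
    refine ⟨max m m', fun k hk => ?_⟩
    rw [Pi.add_apply, Pi.add_apply, map_add, hm k (le_of_max_le_left hk),
      hm' k (le_of_max_le_right hk)]
  smul_mem' := by
    rintro c x ⟨m, hm⟩
    refine ⟨m, fun k hk => ?_⟩
    rw [Pi.smul_apply, Pi.smul_apply, map_smul, hm k hk]

instance : StarAddMonoid (coherentSeq φ) where
  star x := ⟨star x.1, by
    obtain ⟨m, hm⟩ := x.2
    refine ⟨m, fun k hk => ?_⟩
    rw [Pi.star_apply, Pi.star_apply, UCPMap.map_star, hm k hk]⟩
  star_involutive x := Subtype.ext (star_star x.1)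
  star_add x y := Subtype.ext (star_add x.1 y.1)

instance : StarModule ℂ (coherentSeq φ) := ⟨fun c x => Subtype.ext (star_smul c x.1)⟩

/-- The subspace of the sequences that vanish from some index on. -/
def eventuallyZero : Submodule ℂ (coherentSeq φ) where
  carrier := {x | ∃ m, ∀ k, m ≤ k → x.1 k = 0}
  zero_mem' := ⟨0, fun _ _ => rfl⟩
  add_mem' := by
    rintro x y ⟨m, hm⟩ ⟨m', hm'⟩
    refine ⟨max m m', fun k hk => ?_⟩
    have h1 := hm k (le_of_max_le_left hk)
    have h2 := hm' k (le_of_max_le_right hk)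
    change x.1 k + y.1 k = 0
    rw [h1, h2, add_zero]
  smul_mem' := by
    rintro c x ⟨m, hm⟩
    refine ⟨m, fun k hk => ?_⟩
    change c • x.1 k = 0
    rw [hm k hk, smul_zero]

theorem eventuallyZero_star : ∀ x ∈ eventuallyZero φ, star x ∈ eventuallyZero φ := by
  rintro x ⟨m, hm⟩
  refine ⟨m, fun k hk => ?_⟩
  change star (x.1 k) = 0
  rw [hm k hk, star_zero]

/-- The algebraic inductive limit. -/
abbrev AlgLim : Type u := coherentSeq φ ⧸ eventuallyZero φ

/-- The linear map that sends `x ∈ S_k` to the sequence with the entries `0` for `i < k` and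
`φ_{k,i}(x)` for `i ≥ k`. -/
def toSeq (k : ℕ) : S k →ₗ[ℂ] coherentSeq φ where
  toFun x := ⟨fun i => if h : k ≤ i then (transition φ h).toLin x else 0, ⟨k, fun i hi => by
    simp only [dif_pos hi, dif_pos (hi.trans (Nat.le_succ i)), transition_succ φ hi]⟩⟩
  map_add' x y := by
    apply Subtype.ext
    funext i
    change (if h : k ≤ i then (transition φ h).toLin (x + y) else 0) =
      (if h : k ≤ i then (transition φ h).toLin x else 0) +
      (if h : k ≤ i then (transition φ h).toLin y else 0)
    by_cases h : k ≤ i <;> simp [h]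
  map_smul' c x := by
    apply Subtype.ext
    funext i
    change (if h : k ≤ i then (transition φ h).toLin (c • x) else 0) =
      c • (if h : k ≤ i then (transition φ h).toLin x else 0)
    by_cases h : k ≤ i <;> simp [h]

theorem toSeq_apply {k i : ℕ} (h : k ≤ i) (x : S k) :
    (toSeq φ k x).1 i = (transition φ h).toLin x := dif_pos h

/-- The canonical linear map from `S_k` into the algebraic inductive limit. -/
def algIncl (k : ℕ) : S k →ₗ[ℂ] AlgLim φ := (eventuallyZero φ).mkQ ∘ₗ toSeq φ k

theorem algIncl_transition {k l : ℕ} (h : k ≤ l) (x : S k) :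
    algIncl φ l ((transition φ h).toLin x) = algIncl φ k x := by
  refine (Submodule.Quotient.eq _).2 ⟨l, fun i hi => ?_⟩
  change (toSeq φ l _).1 i - (toSeq φ k _).1 i = 0
  rw [toSeq_apply φ hi, toSeq_apply φ (h.trans hi), transition_trans φ h hi, sub_self]

theorem algIncl_map_transition {k l n : ℕ} (h : k ≤ l) (X : Matrix (Fin n) (Fin n) (S k)) :
    (X.map (transition φ h).toLin).map (algIncl φ l) = X.map (algIncl φ k) := by
  ext i j
  exact algIncl_transition φ h _

theorem algIncl_eq_zero {k : ℕ} {x : S k} (hx : algIncl φ k x = 0) :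
    ∃ l, ∃ h : k ≤ l, (transition φ h).toLin x = 0 := by
  obtain ⟨m, hm⟩ := (Submodule.Quotient.mk_eq_zero _).1 hx
  refine ⟨max k m, le_max_left _ _, ?_⟩
  have := hm (max k m) (le_max_right _ _)
  rwa [toSeq_apply φ (le_max_left _ _)] at this

theorem algIncl_map_eq_zero {k n : ℕ} {X : Matrix (Fin n) (Fin n) (S k)}
    (hX : X.map (algIncl φ k) = 0) :
    ∃ l, ∃ h : k ≤ l, X.map (transition φ h).toLin = 0 := by
  have h1 : ∀ p : Fin n × Fin n, ∃ l, ∃ h : k ≤ l, (transition φ h).toLin (X p.1 p.2) = 0 :=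
    fun p => algIncl_eq_zero φ (congrFun (congrFun hX p.1) p.2)
  choose l hl hz using h1
  refine ⟨k + Finset.univ.sup l, Nat.le_add_right _ _, ?_⟩
  ext i j
  have h2 : l (i, j) ≤ k + Finset.univ.sup l :=
    (Finset.le_sup (Finset.mem_univ (i, j))).trans (Nat.le_add_left _ _)
  rw [Matrix.map_apply, transition_trans φ (hl (i, j)) h2, hz (i, j), map_zero]
  rfl

theorem algIncl_surj (z : AlgLim φ) : ∃ k, ∃ x : S k, algIncl φ k x = z := by
  obtain ⟨y, rfl⟩ := (eventuallyZero φ).mkQ_surjective z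
  obtain ⟨m, hm⟩ := y.2
  refine ⟨m, y.1 m, (Submodule.Quotient.eq _).2 ⟨m, fun i hi => ?_⟩⟩
  change (toSeq φ m _).1 i - y.1 i = 0
  rw [toSeq_apply φ hi, sub_eq_zero]
  induction i, hi using Nat.le_induction with
  | base => rw [transition_self]
  | succ i hi ih => rw [transition_succ φ hi, ih, hm i hi]

theorem algIncl_map_surj {n : ℕ} (Z : Matrix (Fin n) (Fin n) (AlgLim φ)) :
    ∃ k, ∃ X : Matrix (Fin n) (Fin n) (S k), X.map (algIncl φ k) = Z := by
  have h1 : ∀ p : Fin n × Fin n, ∃ k, ∃ x : S k, algIncl φ k x = Z p.1 p.2 :=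
    fun p => algIncl_surj φ _
  choose k x hx using h1
  have hk : ∀ p, k p ≤ Finset.univ.sup k := fun p => Finset.le_sup (Finset.mem_univ p)
  refine ⟨Finset.univ.sup k, Matrix.of fun i j => (transition φ (hk (i, j))).toLin (x (i, j)), ?_⟩
  ext i j
  rw [Matrix.map_apply, Matrix.of_apply, algIncl_transition, hx]

/-- The cones of the inductive limit: the union over `k` of the images of the cones of `S_k`. -/
def limCone (n : ℕ) : Set (Matrix (Fin n) (Fin n) (AlgLim φ)) :=
  {Z | ∃ k, ∃ X ∈ (S k).cone n, Z = X.map (algIncl φ k)}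

theorem algIncl_star (k : ℕ) (x : S k) :
    letI := quotStar (eventuallyZero φ) (eventuallyZero_star φ)
    algIncl φ k (star x) = star (algIncl φ k x) := by
  refine (Submodule.Quotient.eq _).2 ⟨k, fun i hi => ?_⟩
  change (toSeq φ k _).1 i - star ((toSeq φ k _).1 i) = 0
  rw [toSeq_apply φ hi, toSeq_apply φ hi, UCPMap.map_star, sub_self]

theorem algIncl_unit (k : ℕ) : algIncl φ k (S k).unit = algIncl φ 0 (S 0).unit := by
  rw [← algIncl_transition φ (Nat.zero_le k), (transition φ (Nat.zero_le k)).map_unit]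

/-- The inductive limit of matrix ordered *-vector spaces with matrix order units. -/
def limMOU : MOUSpace.{u} :=
  letI := quotStar (eventuallyZero φ) (eventuallyZero_star φ)
  haveI := quotStarModule (eventuallyZero φ) (eventuallyZero_star φ)
  { carrier := AlgLim φ
    cone := limCone φ
    unit := algIncl φ 0 (S 0).unit
    cone_hermitian := by
      rintro n _ ⟨k, X, hX, rfl⟩
      have h := (S k).cone_hermitian n X hX
      ext i j
      rw [Matrix.conjTranspose_apply, Matrix.map_apply, Matrix.map_apply, ← algIncl_star]
      exact congrArg _ (congrFun (congrFun h i) j)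
    cone_add := by
      rintro n _ ⟨k, X, hX, rfl⟩ _ ⟨l, Y, hY, rfl⟩
      refine ⟨max k l, _, (S (max k l)).cone_add n _
        ((transition φ (le_max_left k l)).cp n X hX) _
        ((transition φ (le_max_right k l)).cp n Y hY), ?_⟩
      rw [← algIncl_map_transition φ (le_max_left k l) X,
        ← algIncl_map_transition φ (le_max_right k l) Y]
      ext i j
      simp only [Matrix.map_apply, Matrix.add_apply, map_add]
    cone_smul := by
      rintro n _ ⟨k, X, hX, rfl⟩ r hr
      refine ⟨k, _, (S k).cone_smul n X hX r hr, ?_⟩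
      ext i j
      simp only [Matrix.map_apply, Matrix.smul_apply, map_smul]
    cone_proper := by
      rintro n _ ⟨k, X, hX, rfl⟩ ⟨l, Y, hY, h⟩
      have hX' := (transition φ (le_max_left k l)).cp n X hX
      have hY' := (transition φ (le_max_right k l)).cp n Y hY
      rw [← algIncl_map_transition φ (le_max_left k l) X] at h ⊢
      rw [← algIncl_map_transition φ (le_max_right k l) Y] at h
      generalize X.map (transition φ (le_max_left k l)).toLin = X' at *
      generalize Y.map (transition φ (le_max_right k l)).toLin = Y' at *
      generalize max k l = m at *
      have h0 : (X' + Y').map (algIncl φ m) = 0 := by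
        have : (X' + Y').map (algIncl φ m) = X'.map (algIncl φ m) + Y'.map (algIncl φ m) := by
          ext i j
          simp only [Matrix.map_apply, Matrix.add_apply, map_add]
        rw [this, ← h, add_neg_cancel]
      obtain ⟨p, hp, hz⟩ := algIncl_map_eq_zero φ h0
      have h1 := (transition φ hp).cp n _ hX'
      have h2 := (transition φ hp).cp n _ hY'
      have h3 : X'.map (transition φ hp).toLin + Y'.map (transition φ hp).toLin = 0 := by
        rw [← hz]
        ext i j
        simp only [Matrix.map_apply, Matrix.add_apply, map_add]
      rw [← neg_eq_of_add_eq_zero_right h3] at h2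
      rw [← algIncl_map_transition φ hp, (S p).cone_proper n _ h1 h2]
      ext i j
      simp
    cone_compress := by
      rintro n m α _ ⟨k, X, hX, rfl⟩
      exact ⟨k, _, (S k).cone_compress n m α X hX, compress_map α X _⟩
    unit_mem := fun n => ⟨0, _, (S 0).unit_mem n, (map_diagUnit _ _ _ _).symm⟩
    order_unit := by
      intro n Z hZ
      obtain ⟨k, X, rfl⟩ := algIncl_map_surj φ Z
      have hX : (Xᴴ).map (algIncl φ k) = X.map (algIncl φ k) := by
        ext i j
        rw [Matrix.map_apply, Matrix.conjTranspose_apply, algIncl_star]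
        exact congrFun (congrFun hZ i) j
      obtain ⟨r, hr, h⟩ := (S k).order_unit n ((1 / 2 : ℂ) • (X + Xᴴ)) (by
        unfold Matrix.IsHermitian
        rw [Matrix.conjTranspose_smul, Matrix.conjTranspose_add,
          Matrix.conjTranspose_conjTranspose, add_comm]
        simp)
      refine ⟨r, hr, k, _, h, ?_⟩
      have h2 : (diagUnit n (S k).unit r - (1 / 2 : ℂ) • (X + Xᴴ)).map (algIncl φ k)
          = (diagUnit n (S k).unit r).map (algIncl φ k)
            - (1 / 2 : ℂ) • (X.map (algIncl φ k) + (Xᴴ).map (algIncl φ k)) := by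
        ext i j
        simp only [Matrix.map_apply, Matrix.sub_apply, Matrix.smul_apply, Matrix.add_apply,
          map_sub, map_smul, map_add]
      rw [h2, hX, map_diagUnit, algIncl_unit φ k, ← two_smul ℂ, smul_smul]
      norm_num }

/-- The canonical map from `S_k` into the inductive limit of matrix ordered *-vector spaces. -/
def limMOU.incl (k : ℕ) : UCPMap (S k) (limMOU φ) where
  toLin := algIncl φ k
  map_unit := algIncl_unit φ k
  cp := fun _ X hX => ⟨k, X, hX, rfl⟩

end Limit

section LimitOS

variable {S : ℕ → OperatorSystem.{u}} (φ : ∀ k, UCPMap (S k) (S (k + 1)))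

/-- The inductive limit of a sequence of operator systems: the Archimedeanisation of the
inductive limit of the underlying matrix ordered *-vector spaces. -/
def limOS : OperatorSystem.{u} :=
  archimedeanisation (limMOU (S := fun k => (S k).toMOUSpace) φ)

/-- The canonical map `φ_{k,∞}` from `S_k` into the inductive limit. -/
def limOS.incl (k : ℕ) : UCPMap (S k) (limOS φ) :=
  (archimedeanisation.proj _).comp (limMOU.incl (S := fun k => (S k).toMOUSpace) φ k)

theorem limOS.incl_succ (k : ℕ) (x : S k) :
    (limOS.incl φ (k + 1)).toLin ((φ k).toLin x) = (limOS.incl φ k).toLin x := by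
  have h := algIncl_transition (S := fun k => (S k).toMOUSpace) φ (Nat.le_succ k) x
  rw [transition_succ (S := fun k => (S k).toMOUSpace) φ (le_refl k), transition_self] at h
  exact congrArg (archimedeanisation.proj _).toLin h

/-- The union of the images `φ_{k,∞}(J_k)`, for subspaces with `φ_k(J_k) ⊆ J_{k+1}`. -/
def unionImages (J : ∀ k, Submodule ℂ (S k))
    (hJ : ∀ k, (J k).map (φ k).toLin ≤ J (k + 1)) : Submodule ℂ (limOS φ) where
  carrier := ⋃ k, (limOS.incl φ k).toLin '' (J k : Set (S k))
  zero_mem' := Set.mem_iUnion.2 ⟨0, 0, (J 0).zero_mem, map_zero _⟩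
  add_mem' := by
    have step : ∀ k l, k ≤ l → (limOS.incl φ k).toLin '' (J k : Set (S k)) ⊆
        (limOS.incl φ l).toLin '' (J l : Set (S l)) := by
      intro k l hkl
      induction l, hkl using Nat.le_induction with
      | base => exact subset_rfl
      | succ l _ ih =>
        refine ih.trans ?_
        rintro _ ⟨x, hx, rfl⟩
        exact ⟨(φ l).toLin x, hJ l ⟨x, hx, rfl⟩, limOS.incl_succ φ l x⟩
    intro a b ha hb
    obtain ⟨k, hk⟩ := Set.mem_iUnion.1 ha
    obtain ⟨l, hl⟩ := Set.mem_iUnion.1 hb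
    obtain ⟨x, hx, rfl⟩ := step k (max k l) (le_max_left _ _) hk
    obtain ⟨y, hy, rfl⟩ := step l (max k l) (le_max_right _ _) hl
    exact Set.mem_iUnion.2 ⟨max k l, x + y, (J _).add_mem hx hy, map_add _ _ _⟩
  smul_mem' := by
    intro c a ha
    obtain ⟨k, x, hx, rfl⟩ := Set.mem_iUnion.1 ha
    exact Set.mem_iUnion.2 ⟨k, c • x, (J k).smul_mem c hx, map_smul _ _ _⟩

/-- `lim J_k`: the norm closure, in the inductive limit, of the union of the images of
the `J_k`. -/
noncomputable def limKernel (J : ∀ k, Submodule ℂ (S k))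
    (hJ : ∀ k, (J k).map (φ k).toLin ≤ J (k + 1)) : Submodule ℂ (limOS φ) :=
  normClosure (limOS φ).toMOUSpace (unionImages φ J hJ)

/-- The maps `ψ_k : S_k / J_k → S_{k+1} / J_{k+1}` of the quotient inductive system. -/
def quotSeqMap {J : ∀ k, Submodule ℂ (S k)} (hker : ∀ k, IsKernel (S k) (J k))
    (hJ : ∀ k, (J k).map (φ k).toLin ≤ J (k + 1)) (k : ℕ) :
    UCPMap (quotient (S k) (J k) (hker k)) (quotient (S (k + 1)) (J (k + 1)) (hker (k + 1))) :=
  quotient.map (φ k) (hker k) (hker (k + 1)) (hJ k)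

end LimitOS

end OpSys

/-! The quotient maps `q_k` induce a unital completely positive map Q = `limProj` from `lim S_k` to
`lim (S_k / J_k)`, and the theorem is a first isomorphism theorem for Q. For that, three things are
needed: Q is surjective, positive matrices lift along Q up to an arbitrarily small multiple of the
unit, and ker Q is the closed union of the images of the `J_k`. The last fact also exhibits that
closure as a kernel.

Surjectivity is clear, since every element of either limit comes from a finite stage. A positive
matrix over `lim (S_k / J_k)` lifts at the cost of two perturbations by (r/2)e, one for the
Archimedeanisation and one for the quotient cone of `S_k / J_k` (`limProj_lift`). By
`exists_iso_quotient_of_lift` this is just what makes the bijection `T ≅ S / ker f` a complete order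
isomorphism.

The substance is the kernel (`limKernel_eq_ker`). Unital completely positive maps are contractive
and the norm of an operator system separates points, so the closure lies in ker Q. Conversely, let x
in `S_k` have class z in ker Q. Then `q_k(x)` represents a null element of the algebraic limit of
the quotients. A null element, being killed by all states, has seminorm 0 by Hahn-Banach
(`elemNorm_le_of_mem_nullSpace`). Positivity in the algebraic limit is witnessed at a finite stage,
so for each ε > 0 the image of x in some `S_l / J_l` has norm below ε. Biproximinality turns this
order-theoretic smallness into metric smallness: some y in `J_l` brings the image of x in `S_l`
within ε of -y. Mapping to the limit puts z within ε of the image of `J_l`. -/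

namespace OpSys

open Matrix

/-! ### Hahn-Banach separation for a cone with order unit -/

section Separation

/-- Hahn--Banach separation for a convex cone `C` with order unit `e` in a real vector space: if all
normalised positive functionals vanish at `z`, then `r e - z ∈ C` for every `r > 0`. -/
theorem smul_sub_mem_of_forall_functional {E : Type*} [AddCommGroup E] [Module ℝ E] (C : Set E)
    (e : E) (C_add : ∀ x ∈ C, ∀ y ∈ C, x + y ∈ C)
    (C_smul : ∀ x ∈ C, ∀ r : ℝ, 0 ≤ r → r • x ∈ C) (he : e ∈ C)
    (hunit : ∀ x : E, ∃ r : ℝ, r • e - x ∈ C) (hproper : ∀ t : ℝ, t • e ∈ C → 0 ≤ t) (z : E)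
    (hz : ∀ g : E →ₗ[ℝ] ℝ, g e = 1 → (∀ x ∈ C, 0 ≤ g x) → g z = 0) (r : ℝ) (hr : 0 < r) :
    r • e - z ∈ C := by
  -- The order-unit gauge p(x) = inf {t : te - x ∈ C} is sublinear. Functionals dominated by p are
  -- exactly the normalised positive ones, so Hahn-Banach for p produces states.
  set A : E → Set ℝ := fun x => {t | t • e - x ∈ C} with hA
  set p : E → ℝ := fun x => sInf (A x)
  have add_mem : ∀ {x y s t}, s ∈ A x → t ∈ A y → s + t ∈ A (x + y) := by
    intro x y s t hs ht
    have := C_add _ hs _ ht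
    simp only [hA, Set.mem_ofPred_eq]
    convert this using 1
    module
  have smul_mem : ∀ {x s c}, 0 ≤ c → s ∈ A x → c * s ∈ A (c • x) := by
    intro x s c hc hs
    have := C_smul _ hs c hc
    simp only [hA, Set.mem_ofPred_eq]
    convert this using 1
    module
  have bdd : ∀ x, BddBelow (A x) := by
    intro x
    -- If te - x and se + x are both in C, so is (t + s)e, whence t ≥ -s.
    obtain ⟨s, hs⟩ := hunit (-x)
    refine ⟨-s, fun t ht => ?_⟩
    have h := hproper (t + s) (by simpa [hA] using add_mem (y := -x) ht hs)
    linarith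
  have p_le : ∀ {x t}, t ∈ A x → p x ≤ t := fun ht => csInf_le (bdd _) ht
  have le_p : ∀ {x a}, (∀ t ∈ A x, a ≤ t) → a ≤ p x := fun h => le_csInf (hunit _) h
  have p_smul_le : ∀ c : ℝ, 0 < c → ∀ x, p (c • x) ≤ c * p x := by
    intro c hc x
    rw [← div_le_iff₀' hc]
    refine le_p fun t ht => ?_
    rw [div_le_iff₀' hc]
    exact p_le (smul_mem hc.le ht)
  have p_smul : ∀ c : ℝ, 0 < c → ∀ x, p (c • x) = c * p x := by
    intro c hc x
    refine le_antisymm (p_smul_le c hc x) ?_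
    have h := p_smul_le c⁻¹ (inv_pos.2 hc) (c • x)
    rw [inv_smul_smul₀ hc.ne', ← div_eq_inv_mul, le_div_iff₀' hc] at h
    exact h
  have p_add : ∀ x y, p (x + y) ≤ p x + p y := by
    intro x y
    rw [← sub_le_iff_le_add]
    refine le_p fun t ht => ?_
    rw [sub_le_comm]
    refine le_p fun s hs => ?_
    rw [sub_le_iff_le_add]
    rw [add_comm s t]
    exact p_le (add_mem ht hs)
  have zero_mem : (0 : E) ∈ C := by simpa using C_smul e he 0 le_rfl
  have p_zero : p 0 = 0 :=
    le_antisymm (p_le (by simpa [hA] using zero_mem))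
      (le_p fun t ht => hproper t (by simpa [hA] using ht))
  have p_neg : ∀ x, -p (-x) ≤ p x := by
    intro x
    have := p_add x (-x)
    rw [add_neg_cancel, p_zero] at this
    linarith
  -- Extend cz ↦ c p(z) from the line through z. Domination by p for negative c is -p(-x) ≤ p(x),
  -- applied to x = cz.
  obtain ⟨g, hg, hgp⟩ := exists_extension_of_le_sublinear
    (LinearPMap.mkSpanSingleton' z (p z) (σ := RingHom.id ℝ) (by
      intro c hc
      rcases smul_eq_zero.1 hc with rfl | rfl
      · simp
      · simp [p_zero])) p p_smul p_add (by
      rintro ⟨x, hx⟩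
      obtain ⟨c, rfl⟩ := Submodule.mem_span_singleton.1 hx
      rw [LinearPMap.mkSpanSingleton'_apply]
      change c * p z ≤ p (c • z)
      rcases lt_trichotomy c 0 with hc | rfl | hc
      · have h1 := p_smul (-c) (neg_pos.2 hc) z
        have h2 := p_neg (c • z)
        rw [← neg_smul, h1] at h2
        linarith
      · simp [p_zero]
      · rw [p_smul c hc])
  have hgz : g z = p z := by
    have := hg ⟨z, Submodule.mem_span_singleton_self z⟩
    exact this.trans (LinearPMap.mkSpanSingleton'_apply_self _ _ _ _)
  -- From p(e) ≤ 1 and p(-e) ≤ -1, both witnessed by 0 ∈ C.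
  have hge : g e = 1 := by
    refine le_antisymm ((hgp e).trans (p_le (by simpa [hA] using zero_mem))) ?_
    have h1 : p (-e) ≤ -1 := p_le (by simpa [hA] using zero_mem)
    have h2 := hgp (-e)
    rw [map_neg] at h2
    linarith
  have hgpos : ∀ x ∈ C, 0 ≤ g x := by
    intro x hx
    have h1 : p (-x) ≤ 0 := p_le (by simpa [hA] using hx)
    have h2 := hgp (-x)
    rw [map_neg] at h2
    linarith
  -- Since g attains p at z and vanishes there, p(z) = 0. A t < r with te - z ∈ C is then raised to
  -- r by adding (r - t)e.
  have hpz : p z < r := by rw [← hgz, hz g hge hgpos]; exact hr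
  obtain ⟨t, ht, htr⟩ := exists_lt_of_csInf_lt (hunit z) hpz
  have := C_add _ ht _ (C_smul e he (r - t) (sub_nonneg.2 htr.le))
  convert this using 1
  module

end Separation

/-- The `1 × 1` matrix with entry `x`. -/
abbrev single {V : Type*} (x : V) : Matrix (Fin 1) (Fin 1) V := Matrix.of fun _ _ => x

theorem diagUnit_one {V : Type*} [AddCommGroup V] [Module ℂ V] (e : V) (r : ℝ) :
    diagUnit 1 e r = single ((r : ℂ) • e) := by
  ext i j
  simp [diagUnit, Subsingleton.elim i j]

/-! ### Elements killed by all states have seminorm zero -/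

section NullSpace

variable {S : MOUSpace.{u}}

open scoped ComplexStarModule

theorem star_unit : star S.unit = S.unit := by
  have h := diagUnit_hermitian S 1 1
  rw [diagUnit_one, one_hermitian] at h
  simpa using h

/-- The complex linear extension of a real functional on the selfadjoint elements. -/
noncomputable def complexify (g : selfAdjoint S →ₗ[ℝ] ℝ) : S →ₗ[ℂ] ℂ where
  toFun x := g (ℜ x) + Complex.I * g (ℑ x)
  map_add' x y := by
    simp only [map_add, Complex.ofReal_add]
    ring
  map_smul' c x := by
    rw [realPart_smul, imaginaryPart_smul]
    apply Complex.ext <;> simp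

theorem complexify_apply (g : selfAdjoint S →ₗ[ℝ] ℝ) (x : selfAdjoint S) :
    complexify g x = g x := by
  change (g (ℜ (x : S)) : ℂ) + Complex.I * g (ℑ (x : S)) = g x
  rw [selfAdjoint.realPart_coe, selfAdjoint.imaginaryPart_coe]
  simp

/-- Hermitian elements of the null space are infinitesimal. -/
theorem smul_unit_sub_mem_of_nullSpace {z : S} (hz : z ∈ nullSpace S) (hs : star z = z) {r : ℝ}
    (hr : 0 < r) : single ((r : ℂ) • S.unit - z) ∈ S.cone 1 := by
  -- With unit 0 there are no states and the separation lemma does not apply, but then the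
  -- order-unit axiom makes every hermitian element positive.
  by_cases h0 : S.unit = 0
  · have hall : ∀ x : S, star x = x → single x ∈ S.cone 1 := by
      intro x hx
      obtain ⟨t, -, h⟩ := S.order_unit 1 (single (-x)) (one_hermitian.2 (by rw [star_neg, hx]))
      rw [diagUnit_one, h0] at h
      convert h using 1
      ext; simp
    exact hall _ (by simp [star_unit, hs])
  let e : selfAdjoint S := ⟨S.unit, star_unit⟩
  let C : Set (selfAdjoint S) := {x | single (x : S) ∈ S.cone 1}
  have key := smul_sub_mem_of_forall_functional C e
    (fun x hx y hy => by
      change single ((x + y : selfAdjoint S) : S) ∈ S.cone 1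
      have := S.cone_add 1 _ hx _ hy
      convert this using 1
      ext; simp)
    (fun x hx t ht => by
      change single ((t • x : selfAdjoint S) : S) ∈ S.cone 1
      have := S.cone_smul 1 _ hx t ht
      convert this using 1
      ext; simp)
    (by
      have := S.unit_mem 1
      rw [diagUnit_one] at this
      simpa [C] using this)
    (fun x => by
      obtain ⟨t, -, h⟩ := S.order_unit 1 (single (x : S)) (one_hermitian.2 x.2)
      refine ⟨t, ?_⟩
      change single ((t • e - x : selfAdjoint S) : S) ∈ S.cone 1
      rw [diagUnit_one] at h
      convert h using 1
      ext; simp [e])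
    -- For t < 0, both te and -te would be positive, so te = 0 by properness, against e ≠ 0.
    (fun t ht => by
      by_contra hneg
      push Not at hneg
      have h1 : single ((t : ℂ) • S.unit) ∈ S.cone 1 := ht
      have h2 := diagUnit_mem S 1 (neg_pos.2 hneg).le
      have h3 : -single ((t : ℂ) • S.unit) = diagUnit 1 S.unit (-t) := by
        rw [diagUnit_one]; ext; simp
      rw [← h3] at h2
      have h4 := congrFun (congrFun (S.cone_proper 1 _ h1 h2) 0) 0
      have h5 : (t : ℂ) • S.unit = 0 := h4
      rcases smul_eq_zero.1 h5 with h | h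
      · exact hneg.ne (by exact_mod_cast h)
      · exact h0 h)
    ⟨z, hs⟩
    -- The complexification of g is a state, so it kills z.
    (fun g hge hgpos => by
      have := hz (complexify g) ⟨by
          have := complexify_apply g e
          rw [hge] at this
          simpa using this, fun x hx => by
          have hsx : star x = x := one_hermitian.1 (S.cone_hermitian 1 _ hx)
          have h1 := complexify_apply g ⟨x, hsx⟩
          change complexify g x = _ at h1
          rw [h1]
          exact ⟨by simpa using hgpos ⟨x, hsx⟩ hx, by simp⟩⟩
      have h1 := complexify_apply g ⟨z, hs⟩
      change complexify g z = _ at h1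
      rw [this] at h1
      exact_mod_cast h1.symm) r hr
  exact key

/-- For hermitian a, the block [[r, a], [a, r]] is half the sum of (r + a) ⊗ [[1, 1], [1, 1]] and (r
- a) ⊗ [[1, -1], [-1, 1]], that is, of the compressions of r + a and r - a by the rows (1, 1) and
(1, -1). -/
theorem elemNorm_le_of_mem {a : S} (hs : star a = a) {r : ℝ} (hr : 0 ≤ r)
    (h1 : single ((r : ℂ) • S.unit + a) ∈ S.cone 1)
    (h2 : single ((r : ℂ) • S.unit - a) ∈ S.cone 1) : elemNorm S a ≤ r := by
  refine opNorm_le S hr ?_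
  have k1 := S.cone_compress 1 2 (Matrix.of fun _ _ => 1) _ h1
  have k2 := S.cone_compress 1 2 (Matrix.of fun _ j => if j = 0 then 1 else -1) _ h2
  have k3 := S.cone_smul 2 _ (S.cone_add 2 _ k1 _ k2) (1 / 2) (by norm_num)
  have hinl : finSumFinEquiv (m := 1) (n := 1) (Sum.inl 0) = (0 : Fin 2) := rfl
  have hinr : finSumFinEquiv (m := 1) (n := 1) (Sum.inr 0) = (1 : Fin 2) := rfl
  convert k3 using 1
  ext i j
  obtain ⟨i, rfl⟩ := finSumFinEquiv.surjective i
  obtain ⟨j, rfl⟩ := finSumFinEquiv.surjective j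
  rcases i with i | i <;> rcases j with j | j <;>
    obtain rfl := Subsingleton.elim i 0 <;> obtain rfl := Subsingleton.elim j 0 <;>
    simp only [normBlock, Matrix.reindex_apply, Matrix.submatrix_apply, Equiv.symm_apply_apply,
      Matrix.fromBlocks_apply₁₁, Matrix.fromBlocks_apply₁₂, Matrix.fromBlocks_apply₂₁,
      Matrix.fromBlocks_apply₂₂] <;>
    simp [diagUnit_one, compress, hs, hinl, hinr, -Complex.coe_smul] <;> module

/-- The null space is selfadjoint, so it contains the real and imaginary parts of z. Both are
infinitesimal, hence of seminorm 0, and z is their combination. This converts the definition of the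
Archimedeanisation by states into a statement about norms. -/
theorem elemNorm_le_of_mem_nullSpace {z : S} (hz : z ∈ nullSpace S) {ε : ℝ} (hε : 0 < ε) :
    elemNorm S z < ε := by
  have key : ∀ a : S, a ∈ nullSpace S → star a = a → elemNorm S a < ε / 2 := by
    intro a ha hs
    -- Each of the two parts may cost ε/2; the choice ε/4 keeps the bound strict.
    have hr : 0 < ε / 4 := by linarith
    refine (elemNorm_le_of_mem hs hr.le ?_ (smul_unit_sub_mem_of_nullSpace ha hs hr)).trans_lt
      (by linarith)
    have := smul_unit_sub_mem_of_nullSpace (neg_mem ha) (by rw [star_neg, hs]) hr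
    rwa [sub_neg_eq_add] at this
  have hstar := (nullSpace_isNull S).star_mem z hz
  have h1 : ((ℜ z : selfAdjoint S) : S) ∈ nullSpace S := by
    rw [realPart_apply_coe, ← Complex.coe_smul]
    exact Submodule.smul_mem _ _ (add_mem hz hstar)
  have h2 : ((ℑ z : selfAdjoint S) : S) ∈ nullSpace S := by
    rw [imaginaryPart_apply_coe, ← Complex.coe_smul]
    exact Submodule.smul_mem _ _ (Submodule.smul_mem _ _ (sub_mem hz hstar))
  have h3 := opNorm_add_lt S (key _ h1 (ℜ z).2)
    (opNorm_smul_lt S Complex.I_ne_zero (key _ h2 (ℑ z).2))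
  rw [Complex.norm_I, one_mul, add_halves] at h3
  unfold elemNorm
  convert h3 using 2
  ext
  exact (realPart_add_I_smul_imaginaryPart z).symm

end NullSpace

/-! ### Contractivity, and separation of points by the norm -/

section Norm

theorem UCPMap.map_add_diagUnit {S T : MOUSpace.{u}} (f : UCPMap S T) {n : ℕ} (r : ℝ)
    (X : Matrix (Fin n) (Fin n) S) :
    (diagUnit n S.unit r + X).map f.toLin = diagUnit n T.unit r + X.map f.toLin := by
  rw [← f.map_unit, ← map_diagUnit]
  ext i j
  simp only [Matrix.map_apply, Matrix.add_apply, map_add]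

theorem UCPMap.map_normBlock {S T : MOUSpace.{u}} (f : UCPMap S T) {n : ℕ} (r : ℝ)
    (X : Matrix (Fin n) (Fin n) S) :
    (normBlock S r X).map f.toLin = normBlock T r (X.map f.toLin) := by
  have h : (Xᴴ).map f.toLin = (X.map f.toLin)ᴴ := by
    ext i j
    exact f.map_star _
  unfold normBlock
  rw [← f.map_unit, ← map_diagUnit, ← h, ← Matrix.fromBlocks_map]
  rfl

/-- Contractivity: the amplification of f carries the norm block of X to the norm block of its
image, with the same r. -/
theorem UCPMap.opNorm_map_lt {S T : MOUSpace.{u}} (f : UCPMap S T) {n : ℕ}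
    {X : Matrix (Fin n) (Fin n) S} {ε : ℝ} (h : opNorm S X < ε) :
    opNorm T (X.map f.toLin) < ε := by
  obtain ⟨r, hr, hrε, hm⟩ := exists_of_opNorm_lt S h
  refine (opNorm_le T hr ?_).trans_lt hrε
  rw [← f.map_normBlock]
  exact f.cp _ _ hm

theorem UCPMap.elemNorm_map_lt {S T : MOUSpace.{u}} (f : UCPMap S T) {x : S} {ε : ℝ}
    (h : elemNorm S x < ε) : elemNorm T (f.toLin x) < ε :=
  f.opNorm_map_lt h

/-- The seminorm of an operator system is a norm. -/
theorem eq_zero_of_opNorm_lt {T : OperatorSystem.{u}} {n : ℕ} {X : Matrix (Fin n) (Fin n) T}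
    (h : ∀ ε : ℝ, 0 < ε → opNorm T.toMOUSpace X < ε) : X = 0 := by
  have key : ∀ Y : Matrix (Fin n) (Fin n) T, (∀ ε : ℝ, 0 < ε → opNorm T.toMOUSpace Y < ε) →
      normBlock T.toMOUSpace 0 Y ∈ T.cone (n + n) := by
    intro Y hY
    -- Here re plus the block with corner 0 is the block with corner r; it is positive because some
    -- s < r already works and (r - s)e can be added.
    refine T.archimedean _ _ (normBlock_hermitian _ Y) fun r hr => ?_
    obtain ⟨s, hs, hsr, hm⟩ := exists_of_opNorm_lt _ (hY r hr)
    have := T.cone_add _ _ hm _ (diagUnit_mem T.toMOUSpace (n + n) (sub_nonneg.2 hsr.le))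
    rw [← normBlock_zero, ← normBlock_add, add_zero, add_sub_cancel] at this
    rwa [← normBlock_zero, ← normBlock_add, zero_add, add_zero]
  have h2 := key (-X) fun ε hε => by
    have := opNorm_smul_lt T.toMOUSpace (c := -1) (by norm_num) (h ε hε)
    simpa using this
  -- The block with corner 0 is odd in X, so it and its negative are both positive. Properness makes
  -- it 0, and X is its upper right corner.
  have h3 : -normBlock T.toMOUSpace 0 X = normBlock T.toMOUSpace 0 (-X) := by
    rw [neg_eq_iff_add_eq_zero, ← normBlock_add, add_zero, add_neg_cancel, normBlock_zero]
    ext i j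
    simp [diagUnit]
  rw [← h3] at h2
  have h4 := T.cone_proper _ _ (key X h) h2
  ext i j
  have := congrFun (congrFun h4 (finSumFinEquiv (Sum.inl i))) (finSumFinEquiv (Sum.inr j))
  simpa only [normBlock, Matrix.reindex_apply, Matrix.submatrix_apply, Equiv.symm_apply_apply,
    Matrix.fromBlocks_apply₁₂, Matrix.zero_apply] using this

theorem eq_zero_of_elemNorm_lt {T : OperatorSystem.{u}} {x : T}
    (h : ∀ ε : ℝ, 0 < ε → elemNorm T.toMOUSpace x < ε) : x = 0 :=
  congrFun (congrFun (eq_zero_of_opNorm_lt h) 0) 0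

end Norm

/-! ### First isomorphism theorem for approximately lifting maps -/

/-- A unital completely positive map along which positive matrices lift approximately induces a
unital complete order isomorphism of its image with the quotient by its kernel. -/
theorem exists_iso_quotient_of_lift {S T : OperatorSystem.{u}} (f : UCPMap S T)
    (hsurj : Function.Surjective f.toLin)
    (hlift : ∀ n, ∀ Z ∈ T.cone n, ∀ r : ℝ, 0 < r →
      ∃ Y : Matrix (Fin n) (Fin n) S, Y.map f.toLin = Z ∧ diagUnit n S.unit r + Y ∈ S.cone n)
    {K : Submodule ℂ S} (hK : IsKernel S K) (h : K = LinearMap.ker f.toLin) :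
    ∃ ρ : T ≃ₗ[ℂ] quotient S K hK, IsUnitalCompleteOrderIso ρ ∧
      ∀ x, ρ (f.toLin x) = (quotient.proj S K hK).toLin x := by
  subst h
  let σ : quotient S _ hK ≃ₗ[ℂ] T := f.toLin.quotKerEquivOfSurjective hsurj
  have hσ : ∀ x, σ ((quotient.proj S _ hK).toLin x) = f.toLin x := fun x =>
    f.toLin.quotKerEquivOfSurjective_apply_mk hsurj x
  have hρ : ∀ x, σ.symm (f.toLin x) = (quotient.proj S _ hK).toLin x := fun x => by
    rw [← hσ, LinearEquiv.symm_apply_apply]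
  refine ⟨σ.symm, ⟨?_, ?_, ?_⟩, hρ⟩
  · rw [← f.map_unit, hρ, UCPMap.map_unit]
  · intro n Z hZ r hr
    -- A lift Y with re + Y positive is precisely the witness that the quotient cone asks for.
    obtain ⟨Y, rfl, hY⟩ := hlift n Z hZ r hr
    refine ⟨Y, ?_, hY⟩
    ext i j
    exact (hρ _).symm
  · intro n X hX
    -- Quotient positivity gives positivity in T only after adding each re; the Archimedean property
    -- of T removes the perturbation.
    have aux : ∀ r : ℝ, 0 < r → diagUnit n T.unit r + X.map σ ∈ T.cone n := by
      intro r hr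
      obtain ⟨Y, rfl, hY⟩ := hX r hr
      have h1 := f.cp n _ hY
      rw [f.map_add_diagUnit] at h1
      convert h1 using 2
      ext i j
      exact hσ _
    refine T.archimedean n _ ?_ aux
    have := (T.cone_hermitian n _ (aux 1 one_pos)).sub (diagUnit_hermitian T.toMOUSpace n 1)
    rwa [add_sub_cancel_left] at this

/-! ### Universal property of the algebraic limit -/

section UniversalProperty

variable {S : ℕ → MOUSpace.{u}} (φ : ∀ k, UCPMap (S k) (S (k + 1))) {W : Type*} [AddCommGroup W]
  [Module ℂ W] (g : ∀ k, S k →ₗ[ℂ] W)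

/-- Past any index from which x is coherent, `g k (x k)` is constant, as comparison at `max m n`
shows. Thus `algDesc`, which evaluates at an arbitrarily chosen such index, is well defined and
linear. -/
theorem coherentSeq_apply_eq (hg : ∀ k x, g (k + 1) ((φ k).toLin x) = g k x) {x : ∀ k, S k} {m n : ℕ}
    (hm : ∀ k, m ≤ k → (φ k).toLin (x k) = x (k + 1))
    (hn : ∀ k, n ≤ k → (φ k).toLin (x k) = x (k + 1)) : g m (x m) = g n (x n) := by
  have key : ∀ {m l}, m ≤ l → (∀ k, m ≤ k → (φ k).toLin (x k) = x (k + 1)) →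
      g l (x l) = g m (x m) := by
    intro m l hml h
    induction l, hml using Nat.le_induction with
    | base => rfl
    | succ l hl ih => rw [← h l hl, hg, ih]
  rw [← key (le_max_left m n) hm, key (le_max_right m n) hn]

variable (hg : ∀ k x, g (k + 1) ((φ k).toLin x) = g k x)

/-- The linear map on the algebraic inductive limit induced by a compatible family. -/
noncomputable def algDesc : AlgLim φ →ₗ[ℂ] W :=
  (eventuallyZero φ).liftQ
    { toFun := fun x => g x.2.choose (x.1 x.2.choose)
      map_add' := fun x y => by
        have hx := x.2.choose_spec
        have hy := y.2.choose_spec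
        set m := x.2.choose
        set n := y.2.choose
        rw [coherentSeq_apply_eq φ g hg (n := max m n) (x + y).2.choose_spec
            (fun k hk => by
              change (φ k).toLin (x.1 k + y.1 k) = x.1 (k + 1) + y.1 (k + 1)
              rw [map_add, hx k (le_of_max_le_left hk), hy k (le_of_max_le_right hk)]),
          coherentSeq_apply_eq φ g hg (n := max m n) hx
            (fun k hk => hx k (le_of_max_le_left hk)),
          coherentSeq_apply_eq φ g hg (n := max m n) hy
            (fun k hk => hy k (le_of_max_le_right hk))]
        exact map_add (g _) _ _
      map_smul' := fun c x => by
        have hx := x.2.choose_spec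
        rw [coherentSeq_apply_eq φ g hg (c • x).2.choose_spec
          (n := x.2.choose) (fun k hk => by
              change (φ k).toLin (c • x.1 k) = c • x.1 (k + 1)
              rw [map_smul, hx k hk])]
        exact map_smul (g _) _ _ }
    (by
      rintro x ⟨m, hm⟩
      change g x.2.choose (x.1 x.2.choose) = 0
      rw [coherentSeq_apply_eq φ g hg (n := m) x.2.choose_spec
        (fun k hk => by rw [hm k hk, hm (k + 1) (hk.trans k.le_succ), map_zero]), hm m le_rfl,
        map_zero])

theorem algDesc_algIncl (k : ℕ) (x : S k) : algDesc φ g hg (algIncl φ k x) = g k x := by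
  change g (toSeq φ k x).2.choose ((toSeq φ k x).1 (toSeq φ k x).2.choose) = g k x
  rw [coherentSeq_apply_eq φ g hg (n := k) (toSeq φ k x).2.choose_spec (fun i hi => by
    rw [toSeq_apply φ hi, toSeq_apply φ (hi.trans i.le_succ), transition_succ φ hi]),
    toSeq_apply φ le_rfl, transition_self]

end UniversalProperty

/-! ### Maps out of the limit, and descent of norm estimates to finite stages -/

section LimitMaps

variable {S : ℕ → MOUSpace.{u}} (φ : ∀ k, UCPMap (S k) (S (k + 1)))

/-- The unital completely positive map on the inductive limit of matrix ordered spaces induced by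
a compatible family. -/
noncomputable def limMOU.desc {T : MOUSpace.{u}} (g : ∀ k, UCPMap (S k) T)
    (hg : ∀ k x, (g (k + 1)).toLin ((φ k).toLin x) = (g k).toLin x) : UCPMap (limMOU φ) T where
  toLin := algDesc φ (fun k => (g k).toLin) hg
  map_unit := (algDesc_algIncl φ (fun k => (g k).toLin) hg 0 _).trans (g 0).map_unit
  cp := by
    rintro n _ ⟨k, X, hX, rfl⟩
    convert (g k).cp n X hX using 1
    ext i j
    exact algDesc_algIncl φ (fun k => (g k).toLin) hg k _

/-- A matrix over `S_k` of small norm in the limit has small norm at some later stage. -/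
theorem exists_opNorm_transition_lt {k n : ℕ} {X : Matrix (Fin n) (Fin n) (S k)} {ε : ℝ}
    (h : opNorm (limMOU φ) (X.map (limMOU.incl φ k).toLin) < ε) :
    ∃ l, ∃ hl : k ≤ l, opNorm (S l) (X.map (transition φ hl).toLin) < ε := by
  obtain ⟨r, hr, hrε, hm⟩ := exists_of_opNorm_lt _ h
  rw [← UCPMap.map_normBlock] at hm
  -- The norm block of X and a positive P over `S l` agree only in the algebraic limit. Move both to
  -- `max k l`; their difference then vanishes at some later stage m, where the block of X is the
  -- image of P and hence positive.
  obtain ⟨l, P, hP, hPX⟩ := hm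
  change (normBlock (S k) r X).map (algIncl φ k) = P.map (algIncl φ l) at hPX
  rw [← algIncl_map_transition φ (le_max_left k l), ← algIncl_map_transition φ (le_max_right k l)]
    at hPX
  obtain ⟨m, hm, h0⟩ := algIncl_map_eq_zero φ
    (X := (normBlock (S k) r X).map (transition φ (le_max_left k l)).toLin
      - P.map (transition φ (le_max_right k l)).toLin) (by
      rw [← sub_eq_zero] at hPX
      rw [← hPX]
      ext i j
      simp only [Matrix.map_apply, Matrix.sub_apply, map_sub])
  refine ⟨m, (le_max_left k l).trans hm, (opNorm_le _ hr ?_).trans_lt hrε⟩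
  rw [← UCPMap.map_normBlock]
  convert (transition φ hm).cp _ _ ((transition φ (le_max_right k l)).cp _ _ hP) using 1
  ext i j
  have := congrFun (congrFun h0 i) j
  simp only [Matrix.map_apply, Matrix.sub_apply, map_sub, Matrix.zero_apply, sub_eq_zero] at this
  rw [Matrix.map_apply, transition_trans φ (le_max_left k l) hm]
  exact this

/-- Morphisms of inductive systems commute with the transition maps. -/
theorem transition_comm {T : ℕ → MOUSpace.{u}} (ψ : ∀ k, UCPMap (T k) (T (k + 1)))
    (q : ∀ k, UCPMap (S k) (T k))
    (hq : ∀ k x, (ψ k).toLin ((q k).toLin x) = (q (k + 1)).toLin ((φ k).toLin x)) {k l : ℕ}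
    (h : k ≤ l) (x : S k) :
    (transition ψ h).toLin ((q k).toLin x) = (q l).toLin ((transition φ h).toLin x) := by
  induction l, h using Nat.le_induction with
  | base => rw [transition_self, transition_self]
  | succ l hl ih => rw [transition_succ ψ hl, transition_succ φ hl, ih, hq]

end LimitMaps

/-! ### Maps out of the Archimedean limit -/

section LimitOS

/-- The unital completely positive map on the Archimedeanisation induced by a map into an operator
system. -/
def archimedeanisation.desc {S : MOUSpace.{u}} {T : OperatorSystem.{u}} (f : UCPMap S T) :
    UCPMap (archimedeanisation S) T where
  -- The map f kills the null space: null elements have seminorm 0, f is contractive, and T has a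
  -- genuine norm.
  toLin := (nullSpace S).liftQ f.toLin fun _ hx =>
    eq_zero_of_elemNorm_lt fun _ hε => f.elemNorm_map_lt (elemNorm_le_of_mem_nullSpace hx hε)
  map_unit := f.map_unit
  cp := by
    intro n X hX
    obtain ⟨Y, rfl⟩ := exists_rep (nullSpace S) X
    have aux : ∀ r : ℝ, 0 < r → diagUnit n T.unit r + Y.map f.toLin ∈ T.cone n := by
      intro r hr
      obtain ⟨Z, hZ, hm⟩ := hX r hr
      have h1 := f.cp n _ hm
      rw [f.map_add_diagUnit] at h1
      convert h1 using 2
      ext i j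
      have h2 := (Submodule.Quotient.eq _).1 (congrFun (congrFun hZ i) j)
      have h3 : f.toLin (Z i j - Y i j) = 0 := eq_zero_of_elemNorm_lt fun _ hε =>
        f.elemNorm_map_lt (elemNorm_le_of_mem_nullSpace h2 hε)
      rw [map_sub, sub_eq_zero] at h3
      exact h3.symm
    have h := T.archimedean n (Y.map f.toLin) (by
      have := (T.cone_hermitian n _ (aux 1 one_pos)).sub (diagUnit_hermitian T.toMOUSpace n 1)
      rwa [add_sub_cancel_left] at this) aux
    exact h

variable {S : ℕ → OperatorSystem.{u}} (φ : ∀ k, UCPMap (S k) (S (k + 1)))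

/-- The unital completely positive map on the inductive limit induced by a compatible family. -/
noncomputable def limOS.desc {T : OperatorSystem.{u}} (g : ∀ k, UCPMap (S k) T)
    (hg : ∀ k x, (g (k + 1)).toLin ((φ k).toLin x) = (g k).toLin x) : UCPMap (limOS φ) T :=
  archimedeanisation.desc (limMOU.desc (S := fun k => (S k).toMOUSpace) φ g hg)

theorem limOS.desc_incl {T : OperatorSystem.{u}} (g : ∀ k, UCPMap (S k) T)
    (hg : ∀ k x, (g (k + 1)).toLin ((φ k).toLin x) = (g k).toLin x) (k : ℕ) (x : S k) :
    (limOS.desc φ g hg).toLin ((limOS.incl φ k).toLin x) = (g k).toLin x :=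
  algDesc_algIncl (S := fun k => (S k).toMOUSpace) φ (fun k => (g k).toLin) hg k x

theorem limOS.incl_surj (z : limOS φ) : ∃ k, ∃ x : S k, (limOS.incl φ k).toLin x = z := by
  obtain ⟨y, rfl⟩ := Submodule.mkQ_surjective _ z
  obtain ⟨k, x, rfl⟩ := algIncl_surj (S := fun k => (S k).toMOUSpace) φ y
  exact ⟨k, x, rfl⟩

theorem limOS.incl_transition {k l : ℕ} (h : k ≤ l) (x : S k) :
    (limOS.incl φ l).toLin ((transition (S := fun k => (S k).toMOUSpace) φ h).toLin x)
      = (limOS.incl φ k).toLin x :=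
  congrArg (archimedeanisation.proj _).toLin
    (algIncl_transition (S := fun k => (S k).toMOUSpace) φ h x)

/-- Up to `r e`, positive matrices over the limit come from positive matrices over some `S_k`. -/
theorem limOS.exists_of_mem_cone {n : ℕ} {Z : Matrix (Fin n) (Fin n) (limOS φ)}
    (hZ : Z ∈ (limOS φ).cone n) {r : ℝ} (hr : 0 < r) :
    ∃ k, ∃ X ∈ (S k).cone n,
      X.map (limOS.incl φ k).toLin = diagUnit n (limOS φ).unit r + Z := by
  obtain ⟨Y, rfl, k, X, hX, hY⟩ := hZ r hr
  refine ⟨k, X, hX, ?_⟩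
  have := (archimedeanisation.proj (limMOU (S := fun k => (S k).toMOUSpace) φ)).map_add_diagUnit
    r Y
  rw [hY] at this
  exact this

/-- If `x ∈ S_k` vanishes in the limit, its norm becomes small at some later stage. -/
theorem limOS.exists_elemNorm_transition_lt {k : ℕ} {x : S k}
    (hx : (limOS.incl φ k).toLin x = 0) {ε : ℝ} (hε : 0 < ε) :
    ∃ l, ∃ hl : k ≤ l, elemNorm (S l).toMOUSpace
      ((transition (S := fun k => (S k).toMOUSpace) φ hl).toLin x) < ε :=
  exists_opNorm_transition_lt (S := fun k => (S k).toMOUSpace) φ (X := single x)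
    (elemNorm_le_of_mem_nullSpace ((Submodule.Quotient.mk_eq_zero _).1 hx) hε)

/-! ### The induced map between the limits: lifting and kernel -/

variable {J : ∀ k, Submodule ℂ (S k)} (hker : ∀ k, IsKernel (S k) (J k))
  (hJ : ∀ k, (J k).map (φ k).toLin ≤ J (k + 1))

/-- The map `lim S_k → lim (S_k / J_k)` induced by the quotient maps. -/
noncomputable def limProj : UCPMap (limOS φ) (limOS (quotSeqMap φ hker hJ)) :=
  limOS.desc φ (fun k => (limOS.incl (quotSeqMap φ hker hJ) k).comp (quotient.proj _ _ (hker k)))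
    fun k x => limOS.incl_succ (quotSeqMap φ hker hJ) k ((quotient.proj _ _ (hker k)).toLin x)

theorem limProj_incl (k : ℕ) (x : S k) :
    (limProj φ hker hJ).toLin ((limOS.incl φ k).toLin x)
      = (limOS.incl (quotSeqMap φ hker hJ) k).toLin ((quotient.proj _ _ (hker k)).toLin x) :=
  limOS.desc_incl φ _ _ k x

theorem limProj_surjective : Function.Surjective (limProj φ hker hJ).toLin := by
  intro z
  obtain ⟨k, y, rfl⟩ := limOS.incl_surj _ z
  obtain ⟨x, rfl⟩ := (J k).mkQ_surjective y
  exact ⟨(limOS.incl φ k).toLin x, limProj_incl φ hker hJ k x⟩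

theorem limProj_lift (n : ℕ) (Z : Matrix (Fin n) (Fin n) (limOS (quotSeqMap φ hker hJ)))
    (hZ : Z ∈ (limOS (quotSeqMap φ hker hJ)).cone n) (r : ℝ) (hr : 0 < r) :
    ∃ Y : Matrix (Fin n) (Fin n) (limOS φ), Y.map (limProj φ hker hJ).toLin = Z ∧
      diagUnit n (limOS φ).unit r + Y ∈ (limOS φ).cone n := by
  -- One r/2 pays for the Archimedeanisation: X is positive over `S_k / J_k` and represents (r/2)e +
  -- Z. The other pays for the quotient cone: X lifts to W with (r/2)e + W positive. Subtracting
  -- (r/2)e from the image of W gives a lift Y of Z, and re + Y is the image of (r/2)e + W.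
  obtain ⟨k, X, hX, hXZ⟩ := limOS.exists_of_mem_cone _ hZ (half_pos hr)
  obtain ⟨W, rfl, hW⟩ := hX (r / 2) (half_pos hr)
  refine ⟨W.map (limOS.incl φ k).toLin - diagUnit n (limOS φ).unit (r / 2), ?_, ?_⟩
  · rw [← sub_eq_iff_eq_add'] at hXZ
    rw [← hXZ, ← (limProj φ hker hJ).map_unit, ← map_diagUnit]
    ext i j
    simp only [Matrix.map_apply, Matrix.sub_apply, map_sub]
    rw [limProj_incl]
    rfl
  · have h := (limOS.incl φ k).cp n _ hW
    rw [UCPMap.map_add_diagUnit] at h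
    convert h using 1
    nth_rewrite 1 [← add_halves r]
    rw [diagUnit_add]
    abel

/-- Biproximinality at matrix size 1: the norm of the quotient operator system is an infimum over
the coset, so a strict bound on it is met by an actual representative. -/
theorem exists_mem_elemNorm_add_lt {S : OperatorSystem.{u}} {J : Submodule ℂ S}
    {hJ : IsKernel S J} (hbi : IsCompletelyBiproximinal S J hJ) {x : S} {ε : ℝ}
    (h : elemNorm (quotient S J hJ).toMOUSpace ((quotient.proj S J hJ).toLin x) < ε) :
    ∃ y ∈ J, elemNorm S.toMOUSpace (x + y) < ε := by
  have h1 : quotNorm S J (single x) < ε := (hbi 1 (single x)).symm.trans_lt h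
  have hne : {t : ℝ | ∃ Y : Matrix (Fin 1) (Fin 1) S, (∀ i j, Y i j ∈ J) ∧
      t = opNorm S.toMOUSpace (single x + Y)}.Nonempty := ⟨_, 0, fun _ _ => J.zero_mem, rfl⟩
  obtain ⟨_, ⟨Y, hY, rfl⟩, h2⟩ := exists_lt_of_csInf_lt hne h1
  refine ⟨Y 0 0, hY 0 0, ?_⟩
  have e : single (x + Y 0 0) = single x + Y := by
    ext i j
    rw [Subsingleton.elim i 0, Subsingleton.elim j 0]
    rfl
  unfold elemNorm
  rwa [← e] at h2

/-- The inclusion from left to right is contractivity. The reverse one approximates: an element of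
the kernel becomes small in some `S_l / J_l`, and biproximinality corrects it by an element of
`J_l`. -/
theorem limKernel_eq_ker (hbi : ∀ k, IsCompletelyBiproximinal (S k) (J k) (hker k)) :
    limKernel φ J hJ = LinearMap.ker (limProj φ hker hJ).toLin := by
  ext z
  rw [LinearMap.mem_ker]
  constructor
  · intro hz
    refine eq_zero_of_elemNorm_lt fun ε hε => ?_
    obtain ⟨y, hy, hlt⟩ := hz ε hε
    obtain ⟨k, x, hx, rfl⟩ := Set.mem_iUnion.1 hy
    have h0 : (quotient.proj _ _ (hker k)).toLin x = 0 := (Submodule.Quotient.mk_eq_zero _).2 hx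
    have := (limProj φ hker hJ).elemNorm_map_lt hlt
    rwa [map_sub, limProj_incl, h0, map_zero, sub_zero] at this
  · intro hz ε hε
    obtain ⟨k, x, rfl⟩ := limOS.incl_surj φ z
    rw [limProj_incl] at hz
    obtain ⟨l, hl, hlt⟩ := limOS.exists_elemNorm_transition_lt _ hz hε
    rw [transition_comm (S := fun k => (S k).toMOUSpace)
      (T := fun k => (quotient (S k) (J k) (hker k)).toMOUSpace) φ _
      (fun k => quotient.proj _ _ (hker k)) (fun _ _ => rfl)] at hlt
    obtain ⟨y, hy, hlt⟩ := exists_mem_elemNorm_add_lt (hbi l) hlt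
    -- The sign arises because the closure measures a difference, while y is added to the
    -- representative.
    refine ⟨(limOS.incl φ l).toLin (-y), Set.mem_iUnion.2 ⟨l, -y, neg_mem hy, rfl⟩, ?_⟩
    have := (limOS.incl φ l).elemNorm_map_lt hlt
    rwa [map_add, limOS.incl_transition, ← sub_neg_eq_add, ← map_neg] at this

end LimitOS

end OpSys

theorem theorem4p23 (S : ℕ → OpSys.OperatorSystem.{u})
    (φ : ∀ k, OpSys.UCPMap (S k).toMOUSpace (S (k + 1)).toMOUSpace)
    (J : ∀ k, Submodule ℂ (S k))
    (hker : ∀ k, OpSys.IsKernel (S k) (J k))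
    (hbi : ∀ k, OpSys.IsCompletelyBiproximinal (S k) (J k) (hker k))
    (hJ : ∀ k, (J k).map (φ k).toLin ≤ J (k + 1)) :
    ∃ hlim : OpSys.IsKernel (OpSys.limOS φ) (OpSys.limKernel φ J hJ),
      ∃ ρ : OpSys.limOS (OpSys.quotSeqMap φ hker hJ) ≃ₗ[ℂ]
          OpSys.quotient (OpSys.limOS φ) (OpSys.limKernel φ J hJ) hlim,
        OpSys.IsUnitalCompleteOrderIso ρ ∧
        ∀ (k : ℕ) (x : S k),
          ρ ((OpSys.limOS.incl (OpSys.quotSeqMap φ hker hJ) k).toLin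
              ((OpSys.quotient.proj (S k) (J k) (hker k)).toLin x)) =
            (OpSys.quotient.proj (OpSys.limOS φ) (OpSys.limKernel φ J hJ) hlim).toLin
              ((OpSys.limOS.incl φ k).toLin x) := by
  have hK := OpSys.limKernel_eq_ker φ hker hJ hbi
  -- The map that realises the closure as a kernel is `limProj` itself.
  have hlim : OpSys.IsKernel (OpSys.limOS φ) (OpSys.limKernel φ J hJ) := ⟨_, _, hK⟩
  obtain ⟨ρ, hρ, h⟩ := OpSys.exists_iso_quotient_of_lift (OpSys.limProj φ hker hJ)
    (OpSys.limProj_surjective φ hker hJ) (OpSys.limProj_lift φ hker hJ) hlim hK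
  refine ⟨hlim, ρ, hρ, fun k x => ?_⟩
  rw [← OpSys.limProj_incl, h]
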